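/- **Problem.** Let $\mathbf x=(x_1,\dots,x_N)$ with blocks $x_i\in\mathbb R^{n_i}$, and let $\mathcal N_i\subseteq\{1,\dots,N\}$ satisfy $i\in\mathcal N_i$ and $j\in\mathcal N_i\Leftrightarrow i\in\mathcal N_j$. Put $\rho=\max_i|\mathcal N_i|$, $\mathbf x_{\mathcal N_i}=(x_j)_{j\in\mathcal N_i}$, $\mathcal X=\prod_i\mathcal X_i$, $\mathcal X_{\mathcal N_i}=\prod_{j\in\mathcal N_i}\mathcal X_j$. Consider $$\min_{\mathbf x\in\mathcal X}V(\mathbf x)=F(\mathbf x)+G(\mathbf x),\qquad F(\mathbf x)=\sum_i f_i(\mathbf x_{\mathcal N_i}),\quad G(\mathbf x)=\sum_i g_i(x_i).$$ **Assumption A** (for a starting point $\mathbf x^0\in\mathcal X$). Each $\mathcal X_i\subseteq\mathbb R^{n_i}$ is nonempty, closed and convex; each $g_i:\mathcal X_i\to\mathbb R$ is convex and lower semicontinuous; $V$ attains its minimum on $\mathcal X$; each $f_i$ is $C^1$ on an open set containing $\mathcal X_{\mathcal N_i}$; and either (a) $\mathcal L^0=\{\mathbf x\in\mathcal X: V(\mathbf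 x)\le V(\mathbf x^0)\}$ is compact and all $\nabla_{x_j}f_i$ ($j\in\mathcal N_i$) are locally Lipschitz on $\mathcal X_{\mathcal N_i}$, or (b) all $\nabla_{x_j}f_i$ are globally Lipschitz on $\mathcal X_{\mathcal N_i}$. **Assumption B.** Let $\mathcal X^\star$ be the set of stationary solutions, i.e. of $\mathbf x\in\mathcal X$ with $\langle\nabla F(\mathbf x),\mathbf y-\mathbf x\rangle+G(\mathbf y)-G(\mathbf x)\ge0$ for all $\mathbf y\in\mathcal X$, and let $\mathrm{prox}_G(\mathbf z)=\arg\min_{\mathbf y\in\mathcal X}\{G(\mathbf y)+\frac12\|\mathbf y-\mathbf z\|^2\}$ and $r(\mathbf x)=\|\mathbf x-\mathrm{prox}_G(\mathbf x-\nabla F(\mathbf x))\|$. (B1) For every $\eta>\min_{\mathcal X}V$ there are $\epsilon,\kappa>0$ such that every $\mathbf x\in\mathcal X$ with $V(\mathbf x)\le\eta$ and $r(\mathbf x)\le\epsilon$ satisfies $\mathrm{dist}(\mathbf x,\mathcal X^\star)\le\kappa\,r(\mathbf x)$. (B2) There is $\delta>0$ such that $\|\mathbf x-\mathbf y\|\ge\delta$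 for all $\mathbf x,\mathbf y\in\mathcal X^\star$ with $V(\mathbf x)\ne V(\mathbf y)$. **Assumption C** (surrogates $\tilde f_i(\cdot\,;\cdot)$ on $\mathcal X_i\times\mathcal X_{\mathcal N_i}$; $\nabla\tilde f_i$ is the gradient in the first argument). With $\tau>0$ and $L_i\ge0$: $\tilde f_i(\cdot;\mathbf y)$ is $C^1$ and $\tau$-strongly convex on $\mathcal X_i$; $\nabla\tilde f_i(y_i;\mathbf y_{\mathcal N_i})=\nabla_{x_i}f_i(\mathbf y_{\mathcal N_i})$ for $\mathbf y\in\mathcal X$; and $\nabla\tilde f_i(z;\cdot)$ is $L_i$-Lipschitz on $\mathcal X_{\mathcal N_i}$ for every $z\in\mathcal X_i$. Put $L_m=\max_iL_i$. **Algorithm and Assumption D.** At iteration $k\ge0$ one agent $i=i^k$ computes $$\hat x_i^k=\arg\min_{x_i\in\mathcal X_i}\Big\{\tilde f_i\big(x_i;\mathbf x_{\mathcal N_i}^{k-\mathbf d^k(i,i)}\big)+\sum_{j\in\mathcal N_i\setminus\{i\}}\big\langle\nabla_{x_i}f_j\big(\mathbf x_{\mathcal N_j}^{k-\mathbf d^k(i,j)}\big),x_i-x_i^k\big\rangle+g_i(x_i)\Big\},$$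 where $\mathbf x_{\mathcal N_j}^{k-\mathbf d^k(i,j)}=(x_l^{k-d_l^k(i,j)})_{l\in\mathcal N_j}$, $d^k_i(i,i)=0$ and $\mathbf x^t=\mathbf x^0$ for $t<0$; it sets $x_i^{k+1}=x_i^k+\gamma(\hat x_i^k-x_i^k)$ with $\gamma\in(0,1]$, and the other blocks do not change. There are $B\ge N$ and $0\le D\le B$ such that every agent is active at least once in every window $\{k,\dots,k+B-1\}$, and all delays $d^k_l(i,j)$ are at most $D$. **The constant $L$.** Call $L>0$ admissible if (b) holds and $L$ is a Lipschitz constant of all $\nabla_{x_j}f_i$ on $\mathcal X_{\mathcal N_i}$, or if (a) holds and there are $U$ and $\psi>0$ such that the set $Q=\{\mathbf w\in\mathcal X:\|\mathbf w\|_\infty\le U\}$ contains $\mathcal L^0$, every best response $\hat x_i$ computed from any information $\mathbf w(j)_{\mathcal N_j}$, $j\in\mathcal N_i$, with $\mathbf w(j)\in Q$, satisfies $\|\hat x_i-w_i(i)\|\le\psi$, and $L$ is a Lipschitz constant of all $\nabla_{x_j}f_i$ on the projections to the blocks in $\mathcal N_i$ of $\{\mathbf x\in\mathcal X:\exists\,\mathbf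 w\in Q\ \forall i\ \|x_i-w_i\|\le\psi\}$. **Theorem.** There is a positive function $c$ of $(N,B,D,\rho,L,L_m,\kappa)$ with the following property. Under Assumptions A, B and C an admissible $L$ exists. Moreover let $L$ be any admissible constant, let $\eta\ge V(\mathbf x^0)$ and let $\epsilon,\kappa>0$ be constants for which the implication in (B1) holds at the level $\eta$. Let $\{\mathbf x^k\}$ be generated by the algorithm from $\mathbf x^0$ under Assumption D, with $\gamma\in(0,1]$ and $\gamma/\tau<c(N,B,D,\rho,L,L_m,\kappa)$. Then there is $\mathbf x^\star\in\mathcal X^\star$ such that, with $V^\star=V(\mathbf x^\star)$ and for every $t\in\{0,\dots,B-1\}$, as $k\to\infty$, $$V(\mathbf x^{t+kB})-V^\star=\mathcal O(\lambda^{t+kB}),\qquad\|\mathbf x^{t+kB}-\mathbf x^\star\|=\mathcal O\big(\sqrt{\lambda^{t+kB}}\big),$$ where $\lambda\in(0,1)$ is $$\lambda=1-\frac{\gamma^2}{2}\cdot\frac{e}{2N\alpha_1+2(B-N)\alpha_2+\gamma(2-\gamma)e},\qquad e=2\tau-\gamma L(BD\rho^2+2),$$ and, with $K=\kappa^2(1+L+NL_m)^2$,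 $H=L_m^2+(\rho-1)L^2$, $C_2=3\gamma^2(B+2D-N+1)\rho H/\tau^2$, $$\alpha_1=(1-\gamma)\Big(\beta_3+\tfrac{L\gamma(\rho^2LD^2\gamma+1)+1}{2}\Big)+\rho L\beta_1+\beta_4,\qquad \alpha_2=(1-\gamma)\Big(\beta_3+\tfrac{L\gamma(\rho^2LD^2\gamma+1)+1}{2}\Big)+\rho L\beta_2+\beta_5,$$ $$\beta_1=C_2\big(K(2N+1)+N(1+\gamma^2)\big)+K+1+\gamma^2(B-N+2),$$ $$\beta_2=C_2\big(3K(2N+1)+N(3+\gamma^2)\big)+6K+3+\tfrac{\gamma^2}{2}(3B-3N+5),$$ $$\beta_3=2(L^2+L_m^2)(2NC_2+D\gamma^2+1)+\tfrac12,$$ $$\beta_4=2C_2\big(2K(2N+1)+NH\big)+2K+H(1+D\gamma^2)+2\gamma^2,\qquad \beta_5=H(2NC_2+D\gamma^2+2)+\gamma^2.$$ -/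

import Mathlib

open Filter Topology Asymptotics
open scoped NNReal

noncomputable section

/-- The data of the partitioned problem
`min ∑ i, f i (x_{N_i}) + ∑ i, g i (x_i)` subject to `x_i ∈ X i`, with `N` agents.
Block `i` lives in `ℝ^(n i)`; `Nb i` is the neighbourhood of agent `i`, which contains `i`;
the dependence graph is undirected; `f i` is a function of the blocks in `Nb i` only.
Only the values of `g i` on `X i` matter. -/
structure PartitionedProblem (N : ℕ) where
  n : Fin N → ℕ
  Nb : Fin N → Finset (Fin N)
  self_mem : ∀ i, i ∈ Nb i
  symm : ∀ i j, j ∈ Nb i → i ∈ Nb j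
  X : ∀ i, Set (EuclideanSpace ℝ (Fin (n i)))
  f : ∀ i, PiLp 2 (fun j : {j // j ∈ Nb i} => EuclideanSpace ℝ (Fin (n j.1))) → ℝ
  g : ∀ i, EuclideanSpace ℝ (Fin (n i)) → ℝ

namespace PartitionedProblem

variable {N : ℕ} (P : PartitionedProblem N)

/-- The space of the block of agent `i`. -/
abbrev Blk (i : Fin N) : Type := EuclideanSpace ℝ (Fin (P.n i))

/-- The space of all blocks, with the Euclidean norm. -/
abbrev Vec : Type := PiLp 2 (fun i : Fin N => P.Blk i)

/-- The space of the subvectors `x_{N_i}`, with the Euclidean norm. -/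
abbrev NbVec (i : Fin N) : Type := PiLp 2 (fun j : {j // j ∈ P.Nb i} => P.Blk j.1)

/-- `x ↦ x_{N_i}`. -/
def restr (i : Fin N) (x : P.Vec) : P.NbVec i := WithLp.toLp 2 (fun j => x j.1)

/-- The feasible set, the product of the `X i`. -/
def feas : Set P.Vec := {x | ∀ i, x i ∈ P.X i}

/-- The product of the `X j`, `j ∈ N_i`. -/
def feasNb (i : Fin N) : Set (P.NbVec i) := {y | ∀ j, y j ∈ P.X j.1}

/-- The smooth part of the objective. -/
def F (x : P.Vec) : ℝ := ∑ i, P.f i (P.restr i x)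

/-- The nonsmooth part of the objective. -/
def G (x : P.Vec) : ℝ := ∑ i, P.g i (x i)

/-- The objective. -/
def V (x : P.Vec) : ℝ := P.F x + P.G x

/-- The partial gradient `∇_{x_i} f_j` at `y`: the block `i` of the gradient of `f j`, and zero
when `f j` does not depend on `x_i`. -/
def pgrad (j i : Fin N) (y : P.NbVec j) : P.Blk i :=
  if h : i ∈ P.Nb j then gradient (P.f j) y ⟨i, h⟩ else 0

/-- The largest cardinality of a neighbourhood. -/
def rho : ℕ := Finset.univ.sup (fun i => (P.Nb i).card)

/-- The level set of the initial point. -/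
def level (x0 : P.Vec) : Set P.Vec := {x | x ∈ P.feas ∧ P.V x ≤ P.V x0}

/-- All `f i` are continuously differentiable on (an open set containing) the product of the
`X j`, `j ∈ N_i`. -/
def SmoothF : Prop :=
  ∀ i, ∃ U : Set (P.NbVec i), IsOpen U ∧ P.feasNb i ⊆ U ∧ ContDiffOn ℝ 1 (P.f i) U

/-- The level set of `x0` is compact, and all `f i` are block-`LC¹`: continuously
differentiable, with locally Lipschitz partial gradients. -/
def LocalCase (x0 : P.Vec) : Prop :=
  IsCompact (P.level x0) ∧ P.SmoothF ∧
    ∀ i, ∀ j ∈ P.Nb i, LocallyLipschitzOn (P.feasNb i) (P.pgrad i j)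

/-- All `f i` are continuously differentiable, and `L` is a global Lipschitz constant of all
their partial gradients. -/
def GlobalCase (L : ℝ≥0) : Prop :=
  P.SmoothF ∧ ∀ i, ∀ j ∈ P.Nb i, LipschitzOnWith L (P.pgrad i j) (P.feasNb i)

/-- The standing assumptions on the problem, for the initial point `x0`. -/
structure AssumptionA (x0 : P.Vec) : Prop where
  nonempty : ∀ i, (P.X i).Nonempty
  closed : ∀ i, IsClosed (P.X i)
  convex : ∀ i, Convex ℝ (P.X i)
  smooth : P.LocalCase x0 ∨ ∃ K, P.GlobalCase K
  g_convex : ∀ i, ConvexOn ℝ (P.X i) (P.g i)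
  g_lsc : ∀ i, LowerSemicontinuousOn (P.g i) (P.X i)
  solvable : ∃ x ∈ P.feas, ∀ y ∈ P.feas, P.V x ≤ P.V y

/-- The set of stationary solutions. -/
def stat : Set P.Vec :=
  {x | x ∈ P.feas ∧
    ∀ y ∈ P.feas, 0 ≤ inner ℝ (gradient P.F x) (y - x) + P.G y - P.G x}

/-- `p = prox_G(z)`: `p` minimizes `G(y) + ‖y - z‖² / 2` over the feasible set. -/
def IsProx (z p : P.Vec) : Prop :=
  p ∈ P.feas ∧ ∀ y ∈ P.feas, P.G p + ‖p - z‖ ^ 2 / 2 ≤ P.G y + ‖y - z‖ ^ 2 / 2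

/-- The Luo-Tseng error bound at level `η`, with constants `ε` and `κ`: every feasible `x` with
`V x ≤ η` and `‖x - prox_G(x - ∇F(x))‖ ≤ ε` satisfies
`d(x, X⋆) ≤ κ ‖x - prox_G(x - ∇F(x))‖`. -/
def ErrorBound (η ε κ : ℝ) : Prop :=
  ∀ x ∈ P.feas, P.V x ≤ η → ∀ p, P.IsProx (x - gradient P.F x) p → ‖x - p‖ ≤ ε →
    Metric.infDist x P.stat ≤ κ * ‖x - p‖

/-- The Luo-Tseng error bound, at every level above the minimum of the objective. -/
def AssumptionB1 : Prop :=
  ∀ η, (∃ x ∈ P.feas, P.V x < η) → ∃ ε > 0, ∃ κ > 0, P.ErrorBound η ε κ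

/-- Distinct stationary values are properly separated. -/
def AssumptionB2 : Prop :=
  ∃ δ > 0, ∀ x ∈ P.stat, ∀ y ∈ P.stat, P.V x ≠ P.V y → δ ≤ ‖x - y‖

/-- A choice of surrogate functions: `s i z y` stands for `f̃_i(z; y)`. -/
abbrev Surrogates : Type := ∀ i, P.Blk i → P.NbVec i → ℝ

variable {P}

/-- The assumptions on the surrogates; `gradient (fun u => s i u y)` is the partial gradient with
respect to the first argument. -/
structure AssumptionC (s : P.Surrogates) (τ : ℝ) (Li : Fin N → ℝ≥0) : Prop where
  tau_pos : 0 < τ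
  smooth : ∀ i, ∀ y ∈ P.feasNb i, ∃ U : Set (P.Blk i), IsOpen U ∧ P.X i ⊆ U ∧
    ContDiffOn ℝ 1 (fun u => s i u y) U
  strong_convex : ∀ i, ∀ y ∈ P.feasNb i, StrongConvexOn (P.X i) τ (fun u => s i u y)
  grad_eq : ∀ i, ∀ y ∈ P.feasNb i,
    gradient (fun u => s i u y) (y ⟨i, P.self_mem i⟩) = P.pgrad i i y
  grad_lipschitz : ∀ i, ∀ z ∈ P.X i,
    LipschitzOnWith (Li i) (fun y => gradient (fun u => s i u y) z) (P.feasNb i)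

/-- `z` is the best response of agent `i` when its own block is `v` and the information it holds
for `f j` is the subvector `w j`, `j ∈ N_i`: `z` minimizes over `X i`
`f̃_i(z; w_i) + ∑_{j ∈ N_i \ {i}} ⟨∇_{x_i} f_j(w_j), z - v⟩ + g_i(z)`. -/
def IsBestResponse (s : P.Surrogates) (i : Fin N) (w : ∀ j, P.NbVec j) (v z : P.Blk i) : Prop :=
  z ∈ P.X i ∧ ∀ u ∈ P.X i,
    s i z (w i) + ∑ j ∈ (P.Nb i).erase i, inner ℝ (P.pgrad j i (w j)) (z - v) + P.g i z ≤
    s i u (w i) + ∑ j ∈ (P.Nb i).erase i, inner ℝ (P.pgrad j i (w j)) (u - v) + P.g i u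

/-- The subvector `[x_l^{k - d l}]_{l ∈ N_j}`. Subtraction of natural numbers is truncated, which
is the convention `x^t = x^0` for `t < 0`. -/
def delayed (x : ℕ → P.Vec) (k : ℕ) (d : Fin N → ℕ) (j : Fin N) : P.NbVec j :=
  WithLp.toLp 2 (fun l => x (k - d l.1) l.1)

/-- `x` is a sequence generated by the asynchronous algorithm with stepsize `γ`, where `a k` is the
agent that performs iteration `k`, and `d k i j l` is the delay at iteration `k` of the
information of agent `i` on the block `l` in `f j`. Agents know their own current block. -/
structure IsRun (s : P.Surrogates) (γ : ℝ) (a : ℕ → Fin N)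
    (d : ℕ → Fin N → Fin N → Fin N → ℕ) (x : ℕ → P.Vec) : Prop where
  init : x 0 ∈ P.feas
  own_delay : ∀ k i, d k i i i = 0
  update : ∀ k, ∃ z : P.Blk (a k),
    IsBestResponse s (a k) (fun j => delayed x k (d k (a k) j) j) (x k (a k)) z ∧
    x (k + 1) (a k) = x k (a k) + γ • (z - x k (a k))
  keep : ∀ k i, i ≠ a k → x (k + 1) i = x k i

/-- Every agent is active in every window of `B` consecutive iterations, and all delays are at most
`D`. -/
structure AssumptionD (P : PartitionedProblem N) (B D : ℕ) (a : ℕ → Fin N)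
    (d : ℕ → Fin N → Fin N → Fin N → ℕ) : Prop where
  le_B : N ≤ B
  active : ∀ k i, ∃ t, k ≤ t ∧ t < k + B ∧ a t = i
  D_le : D ≤ B
  delay_le : ∀ k i, ∀ j ∈ P.Nb i, ∀ l ∈ P.Nb j, d k i j l ≤ D

variable (P) in
/-- The feasible points all of whose coordinates are at most `U` in absolute value. -/
def cube (U : ℝ) : Set P.Vec := {w | w ∈ P.feas ∧ ∀ i c, |w i c| ≤ U}

variable (P) in
/-- The feasible points that are blockwise within distance `ψ` of a point of the cube. -/
def wideCube (U ψ : ℝ) : Set P.Vec :=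
  {x | x ∈ P.feas ∧ ∃ w ∈ P.cube U, ∀ i, ‖x i - w i‖ ≤ ψ}

/-- `L` is an admissible Lipschitz constant: either it is a global Lipschitz constant of all
partial gradients of the `f i`, or the level set of `x0` is compact, the `f i` are block-`LC¹`,
and `L` is a Lipschitz constant of all these gradients over a compact set that confines the
iterates and the best responses: a cube that contains the level set of `x0`, widened by
a bound `ψ` on the length of the best-response steps with information from the cube. -/
def IsLipConst (s : P.Surrogates) (x0 : P.Vec) (L : ℝ≥0) : Prop :=
  P.GlobalCase L ∨
  (P.LocalCase x0 ∧ ∃ U ψ : ℝ, 0 < ψ ∧ P.level x0 ⊆ P.cube U ∧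
    (∀ i, ∀ w : Fin N → P.Vec, (∀ j, w j ∈ P.cube U) → ∀ z,
      IsBestResponse s i (fun j => P.restr j (w j)) (w i i) z → ‖z - w i i‖ ≤ ψ) ∧
    ∀ i, ∀ j ∈ P.Nb i, LipschitzOnWith L (P.pgrad i j) (P.restr i '' P.wideCube U ψ))

end PartitionedProblem

/-- The constants on which the rate depends: number of agents `N`, window `B`, maximal delay `D`,
maximal size `rho` of a neighbourhood, Lipschitz constants `L` and `Lm = max L_i`, modulus of
strong convexity `tau`, stepsize `gamma`, error bound constant `kappa`. -/
structure RateData where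
  N : ℝ
  B : ℝ
  D : ℝ
  rho : ℝ
  L : ℝ
  Lm : ℝ
  tau : ℝ
  gamma : ℝ
  kappa : ℝ

namespace RateData

variable (q : RateData)

def C2 : ℝ :=
  3 * q.gamma ^ 2 * (q.B + 2 * q.D - q.N + 1) * q.rho * (q.Lm ^ 2 + (q.rho - 1) * q.L ^ 2)
    / q.tau ^ 2

/-- `κ² (1 + L + N Lm)²`. -/
def K : ℝ := q.kappa ^ 2 * (1 + q.L + q.N * q.Lm) ^ 2

def beta1 : ℝ :=
  q.C2 * (q.K * (2 * q.N + 1) + q.N * (1 + q.gamma ^ 2)) + q.K + 1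
    + q.gamma ^ 2 * (q.B - q.N + 2)

def beta2 : ℝ :=
  q.C2 * (3 * q.K * (2 * q.N + 1) + q.N * (3 + q.gamma ^ 2)) + 6 * q.K + 3
    + q.gamma ^ 2 / 2 * (3 * q.B - 3 * q.N + 5)

def beta3 : ℝ :=
  2 * (q.L ^ 2 + q.Lm ^ 2) * (2 * q.N * q.C2 + q.D * q.gamma ^ 2 + 1) + 1 / 2

def beta4 : ℝ :=
  2 * q.C2 * (2 * q.K * (2 * q.N + 1) + q.N * (q.Lm ^ 2 + q.L ^ 2 * (q.rho - 1))) + 2 * q.K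
    + (q.Lm ^ 2 + q.L ^ 2 * (q.rho - 1)) * (1 + q.D * q.gamma ^ 2) + 2 * q.gamma ^ 2

def beta5 : ℝ :=
  (q.Lm ^ 2 + q.L ^ 2 * (q.rho - 1)) * (2 * q.N * q.C2 + q.D * q.gamma ^ 2 + 2) + q.gamma ^ 2

def alpha1 : ℝ :=
  (1 - q.gamma) *
      (q.beta3 + (q.L * q.gamma * (q.rho ^ 2 * q.L * q.D ^ 2 * q.gamma + 1) + 1) / 2)
    + q.rho * q.L * q.beta1 + q.beta4

def alpha2 : ℝ :=
  (1 - q.gamma) *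
      (q.beta3 + (q.L * q.gamma * (q.rho ^ 2 * q.L * q.D ^ 2 * q.gamma + 1) + 1) / 2)
    + q.rho * q.L * q.beta2 + q.beta5

/-- `2 τ - γ L (B D ρ² + 2)`. -/
def slack : ℝ := 2 * q.tau - q.gamma * q.L * (q.B * q.D * q.rho ^ 2 + 2)

/-- The rate `λ`. -/
def lam : ℝ :=
  1 - q.gamma ^ 2 / 2 * (q.slack /
    (2 * q.N * q.alpha1 + 2 * (q.B - q.N) * q.alpha2 + q.gamma * (2 - q.gamma) * q.slack))

end RateData

/-- The rate `λ` as a function of `ρ`, the `L_i`, `L`, `τ`, `γ`, `N`, `B`, `D` and `κ`. -/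
def asyncRate (N B D rho : ℕ) (L : ℝ≥0) (Li : Fin N → ℝ≥0) (τ γ κ : ℝ) : ℝ :=
  RateData.lam
    { N := N, B := B, D := D, rho := rho, L := L, Lm := ((Finset.univ.sup Li : ℝ≥0) : ℝ),
      tau := τ, gamma := γ, kappa := κ }

end

/-!
The claimed `1 - λ` is quadratic in the stepsize `γ`, whereas the asynchronous method contracts
linearly in `γ` over a bounded number of iterations. So it suffices to prove linear convergence with
crude constants that depend on `N, B, D, L, L_m, κ` only, and then to take `γ` small. A threshold for
`γ / τ` does make `γ` small, because `τ ≤ N (L_m + L)` as soon as one step is nontrivial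
(`Confinement.tau_le`): the surrogate gradient agrees with the true one at both ends of the step.

Both cases of an admissible constant `L` are treated at once through a pair of sets `Q ⊆ W`
(`Confinement`): the iterates stay in `Q`, and all gradients are evaluated in `W`, where they are
`L`-Lipschitz. Let `δ_k` be the length of the best-response step at time `k`. The argument has four
parts.

* Descent (`IsResponseSeq.V_succ_le`): strong convexity decreases the objective by `γ τ δ_k ^ 2`, and
  the delays cost `O(γ ^ 2)` times the sum of the squared steps of the last `D` iterations. A weighted
  sum of past steps turns this into an energy that decreases (`energy_succ_le`). Hence the iterates
  never leave the initial level set, and `δ_k` tends to zero.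
* Error bound (`norm_sub_prox_le`): the prox residual at `x k` is at most a constant times the sum
  `σ_k` of the step lengths in the window from `k - D` to `k + B`. So `x k` is eventually within `O(σ_k)` of
  a stationary point `y k`, and by the separation of stationary values `V (y k)` is eventually
  a constant `V⋆` (`IsResponseSeq.exists_near_stat`).
* Contraction (`IsResponseSeq.V_add_le`): at its first activation in the window each agent still has
  its block of `x k`. Comparing its best response with the block of `y k`, and adding up over the agents,
  gives `V (x (k + B)) - V⋆ ≤ (1 - γ) (V (x k) - V⋆) + γ C σ_k ^ 2`.
* By the descent, `σ_k ^ 2` is bounded by a decrease of the energy, so the energy contracts by the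
  factor `1 - γ / (1 + O(1 / τ))` over `D + B` iterations (`linear_rate_of_delayed_descent`), which is
  at most `λ ^ (D + B)` below the threshold (`one_sub_div_le_pow`). The steps are then `O(√(λ ^ k))`, the
  iterates converge, and the limit is stationary because the stationary set is closed.

The existence of an admissible `L` in the compact case needs a bound for the best responses to bounded
information (`exists_bound_bestResponse`): the strongly convex part of the subproblem dominates the
linear lower bound of `g_i`.
-/

noncomputable section

/-! ### Convex analysis in inner product spaces -/

section ConvexAnalysis

variable {E : Type*} [NormedAddCommGroup E] [InnerProductSpace ℝ E] [CompleteSpace E]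

lemma tendsto_slope_of_hasGradientAt {φ : E → ℝ} {ξ p : E} (hφ : HasGradientAt φ ξ p) (d : E) :
    Tendsto (fun t : ℝ => t⁻¹ * (φ (p + t • d) - φ p)) (𝓝[>] 0) (𝓝 (inner ℝ ξ d)) := by
  have h1 : HasDerivAt (fun t : ℝ => p + t • d) d 0 := by
    simpa using ((hasDerivAt_id (0 : ℝ)).smul_const d).const_add p
  have h2 : HasFDerivAt φ (InnerProductSpace.toDual ℝ E ξ) (p + (0 : ℝ) • d) := by
    simpa using hφ.hasFDerivAt
  have h3 := (h2.comp_hasDerivAt (0 : ℝ) h1).tendsto_slope_zero_right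
  simpa using h3

lemma inner_le_of_forall_le {φ : E → ℝ} {ξ p d : E} {c e : ℝ} (hφ : HasGradientAt φ ξ p)
    (h : ∀ t : ℝ, 0 < t → t < 1 → φ (p + t • d) ≤ φ p + t * (c + t * e)) :
    inner ℝ ξ d ≤ c := by
  have hlim : Tendsto (fun t : ℝ => c + t * e) (𝓝[>] 0) (𝓝 c) := by
    have : Tendsto (fun t : ℝ => c + t * e) (𝓝 0) (𝓝 (c + 0 * e)) :=
      (continuous_const.add (continuous_id.mul continuous_const)).tendsto 0
    rw [zero_mul, add_zero] at this
    exact this.mono_left nhdsWithin_le_nhds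
  refine le_of_tendsto_of_tendsto (tendsto_slope_of_hasGradientAt hφ d) hlim ?_
  filter_upwards [Ioo_mem_nhdsGT (show (0 : ℝ) < 1 by norm_num)] with t ht
  rw [inv_mul_le_iff₀ ht.1]
  linarith [h t ht.1 ht.2]

lemma le_inner_of_forall_le {φ : E → ℝ} {ξ p d : E} {c : ℝ} (hφ : HasGradientAt φ ξ p)
    (h : ∀ t : ℝ, 0 < t → t < 1 → φ p + t * c ≤ φ (p + t • d)) :
    c ≤ inner ℝ ξ d := by
  refine ge_of_tendsto (tendsto_slope_of_hasGradientAt hφ d) ?_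
  filter_upwards [Ioo_mem_nhdsGT (show (0 : ℝ) < 1 by norm_num)] with t ht
  rw [le_inv_mul_iff₀ ht.1]
  linarith [h t ht.1 ht.2]

/-- First-order optimality for the sum of a differentiable and a convex function. -/
lemma variational_inequality_of_forall_le {S : Set E} {φ h : E → ℝ} {ξ p u : E}
    (hh : ConvexOn ℝ S h) (hφ : HasGradientAt φ ξ p) (hp : p ∈ S)
    (hmin : ∀ u ∈ S, φ p + h p ≤ φ u + h u) (hu : u ∈ S) :
    0 ≤ inner ℝ ξ (u - p) + h u - h p := by
  have key : h p - h u ≤ inner ℝ ξ (u - p) := by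
    refine le_inner_of_forall_le hφ fun t ht0 ht1 => ?_
    have hcomb : p + t • (u - p) = (1 - t) • p + t • u := by module
    have h1 := hh.2 hp hu (by linarith : 0 ≤ 1 - t) ht0.le (by ring)
    have h2 := hmin _ (hh.1 hp hu (by linarith : 0 ≤ 1 - t) ht0.le (by ring))
    rw [hcomb]
    simp only [smul_eq_mul] at h1
    linarith
  linarith

/-- The gradient of a `τ`-strongly convex function is `τ`-strongly monotone. -/
lemma StrongConvexOn.mul_norm_sq_le_inner {S : Set E} {φ : E → ℝ} {τ : ℝ} {u v ξ ζ : E}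
    (hφ : StrongConvexOn S τ φ) (hu : u ∈ S) (hv : v ∈ S) (hξ : HasGradientAt φ ξ u)
    (hζ : HasGradientAt φ ζ v) : τ * ‖u - v‖ ^ 2 ≤ inner ℝ (ξ - ζ) (u - v) := by
  have key : ∀ {u v ξ : E}, u ∈ S → v ∈ S → HasGradientAt φ ξ u →
      inner ℝ ξ (v - u) ≤ φ v - φ u - τ / 2 * ‖u - v‖ ^ 2 := by
    intro u v ξ hu hv hξ
    refine inner_le_of_forall_le (e := τ / 2 * ‖u - v‖ ^ 2) hξ fun t ht0 ht1 => ?_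
    have h1 := hφ.2 hu hv (by linarith : 0 ≤ 1 - t) ht0.le (by ring)
    have hcomb : u + t • (v - u) = (1 - t) • u + t • v := by module
    rw [hcomb]
    simp only [smul_eq_mul] at h1
    linarith
  have h1 := key hu hv hξ
  have h2 := key hv hu hζ
  rw [norm_sub_rev v u] at h2
  rw [← neg_sub u v, inner_neg_right] at h1
  rw [inner_sub_left]
  linarith

/-- The error of the first-order expansion along a segment on which the gradient is Lipschitz. -/
lemma abs_sub_sub_inner_le_of_lipschitz_on_segment {φ : E → ℝ} {φ' : E → E} {u v : E} {M : ℝ}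
    (hM : 0 ≤ M) (hφ : ∀ w ∈ segment ℝ u v, HasGradientAt φ (φ' w) w)
    (hL : ∀ w ∈ segment ℝ u v, ‖φ' w - φ' u‖ ≤ M * ‖w - u‖) :
    |φ v - φ u - inner ℝ (φ' u) (v - u)| ≤ M * ‖v - u‖ ^ 2 := by
  have h := Convex.norm_image_sub_le_of_norm_hasFDerivWithin_le'
    (f := φ) (f' := fun w => InnerProductSpace.toDual ℝ E (φ' w))
    (φ := InnerProductSpace.toDual ℝ E (φ' u)) (C := M * ‖v - u‖) (s := segment ℝ u v)
    (fun w hw => (hφ w hw).hasFDerivAt.hasFDerivWithinAt) (fun w hw => ?_)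
    (convex_segment u v) (left_mem_segment ℝ u v) (right_mem_segment ℝ u v)
  · rw [Real.norm_eq_abs, InnerProductSpace.toDual_apply_apply] at h
    linarith [sq (‖v - u‖)]
  · rw [← map_sub, LinearIsometryEquiv.norm_map]
    refine (hL w hw).trans (mul_le_mul_of_nonneg_left ?_ hM)
    obtain ⟨t, ht, rfl⟩ := (segment_eq_image' ℝ u v ▸ hw :
      w ∈ (fun t : ℝ => u + t • (v - u)) '' Set.Icc 0 1)
    rw [add_sub_cancel_left, norm_smul, Real.norm_of_nonneg ht.1]
    exact mul_le_of_le_one_left (norm_nonneg _) ht.2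

end ConvexAnalysis

section Coercivity

variable {E : Type*} [NormedAddCommGroup E] [NormedSpace ℝ E] [ProperSpace E]

/-- A convex lower semicontinuous function on a closed set has a minorant of linear growth: its
minimum over the unit ball around a base point propagates along rays. -/
lemma ConvexOn.exists_linear_lower_bound {S : Set E} {g : E → ℝ} {u₀ : E}
    (hg : ConvexOn ℝ S g) (hS : IsClosed S) (hlsc : LowerSemicontinuousOn g S) (hu₀ : u₀ ∈ S) :
    ∃ C, 0 ≤ C ∧ ∀ u ∈ S, -(C * (1 + ‖u - u₀‖)) ≤ g u := by
  obtain ⟨m, hm, hmin⟩ := LowerSemicontinuousOn.exists_isMinOn (f := g)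
    (s := S ∩ Metric.closedBall u₀ 1) ⟨u₀, hu₀, by simp⟩
    ((isCompact_closedBall u₀ 1).inter_left hS) (hlsc.mono Set.inter_subset_left)
  refine ⟨|g m| + |g u₀|, by positivity, fun u hu => ?_⟩
  have h1 := neg_abs_le (g m)
  have h2 := neg_abs_le (g u₀)
  have h3 := le_abs_self (g u₀)
  have h0 := norm_nonneg (u - u₀)
  rcases le_total ‖u - u₀‖ 1 with hR | hR
  · have : g m ≤ g u := hmin ⟨hu, by simpa [dist_eq_norm] using hR⟩
    nlinarith [abs_nonneg (g m), abs_nonneg (g u₀)]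
  · set R := ‖u - u₀‖ with hRdef
    have hRpos : 0 < R := by linarith
    have hR1 : R⁻¹ ≤ 1 := inv_le_one_of_one_le₀ hR
    have hmem := hg.1 hu₀ hu (by linarith : 0 ≤ 1 - R⁻¹) (by positivity : 0 ≤ R⁻¹) (by ring)
    have hconv := hg.2 hu₀ hu (by linarith : 0 ≤ 1 - R⁻¹) (by positivity : 0 ≤ R⁻¹) (by ring)
    have hball : (1 - R⁻¹) • u₀ + R⁻¹ • u ∈ Metric.closedBall u₀ 1 := by
      have : (1 - R⁻¹) • u₀ + R⁻¹ • u - u₀ = R⁻¹ • (u - u₀) := by module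
      rw [Metric.mem_closedBall, dist_eq_norm, this, norm_smul, Real.norm_of_nonneg (by positivity),
        ← hRdef, inv_mul_cancel₀ hRpos.ne']
    have hle : g m ≤ g _ := hmin ⟨hmem, hball⟩
    have h4 : g m ≤ (1 - R⁻¹) * g u₀ + R⁻¹ * g u := hle.trans hconv
    have h5 : R * g m ≤ (R - 1) * g u₀ + g u := by
      have := mul_le_mul_of_nonneg_left h4 hRpos.le
      have e : R * ((1 - R⁻¹) * g u₀ + R⁻¹ * g u) = (R - 1) * g u₀ + g u := by
        field_simp
      linarith
    nlinarith [abs_nonneg (g m), abs_nonneg (g u₀)]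

/-- The proximal map of a convex lower semicontinuous function is defined everywhere. -/
lemma ConvexOn.exists_prox {S : Set E} {g : E → ℝ} (hg : ConvexOn ℝ S g) (hS : IsClosed S)
    (hlsc : LowerSemicontinuousOn g S) (hne : S.Nonempty) (z : E) :
    ∃ p ∈ S, ∀ u ∈ S, g p + ‖p - z‖ ^ 2 / 2 ≤ g u + ‖u - z‖ ^ 2 / 2 := by
  obtain ⟨u₀, hu₀⟩ := hne
  obtain ⟨C, hC, hlow⟩ := hg.exists_linear_lower_bound hS hlsc hu₀
  set b := ‖u₀ - z‖ with hb
  have hb0 : 0 ≤ b := norm_nonneg _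
  have ha0 : 0 ≤ |g u₀| := abs_nonneg _
  set R := 2 * (b + C + |g u₀| + C + 1) with hR
  have hlsc' : LowerSemicontinuousOn (fun u => g u + ‖u - z‖ ^ 2 / 2)
      (S ∩ Metric.closedBall u₀ R) := by
    have hc : Continuous fun u : E => ‖u - z‖ ^ 2 / 2 := by fun_prop
    exact (hlsc.mono Set.inter_subset_left).add hc.continuousOn.lowerSemicontinuousOn
  obtain ⟨p, hp, hmin⟩ := LowerSemicontinuousOn.exists_isMinOn
    (s := S ∩ Metric.closedBall u₀ R) ⟨u₀, hu₀, by simp; positivity⟩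
    ((isCompact_closedBall u₀ R).inter_left hS) hlsc'
  refine ⟨p, hp.1, fun u hu => ?_⟩
  by_cases hur : ‖u - u₀‖ ≤ R
  · exact hmin ⟨hu, by simpa [dist_eq_norm] using hur⟩
  · -- outside the ball the objective exceeds its value at the base point
    have hle : g p + ‖p - z‖ ^ 2 / 2 ≤ g u₀ + b ^ 2 / 2 :=
      hmin ⟨hu₀, Metric.mem_closedBall_self (by positivity)⟩
    refine hle.trans ?_
    push Not at hur
    set r := ‖u - u₀‖ with hr
    have h1 : r - b ≤ ‖u - z‖ := by
      have : ‖u - u₀‖ ≤ ‖u - z‖ + ‖u₀ - z‖ := by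
        simpa [norm_sub_rev z u₀] using norm_sub_le_norm_sub_add_norm_sub u z u₀
      linarith
    have h2 : (r - b) ^ 2 ≤ ‖u - z‖ ^ 2 := by
      apply pow_le_pow_left₀ _ h1
      linarith
    have h3 := hlow u hu
    have h4 := le_abs_self (g u₀)
    have h5 : (|g u₀| + C + 1) ≤ r / 2 - (b + C) := by linarith
    have h6 : 1 ≤ r := by linarith
    have h7 : r * (|g u₀| + C + 1) ≤ r * (r / 2 - (b + C)) :=
      mul_le_mul_of_nonneg_left h5 (by linarith)
    nlinarith [mul_nonneg (by linarith : 0 ≤ r - 1) (by linarith : 0 ≤ |g u₀| + C + 1)]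

end Coercivity

/-! ### A Lyapunov argument for real sequences with delays -/

/-- A nonnegative antitone sequence that eventually contracts by `lam ^ T` over `T` steps decays like
`lam ^ k`. -/
lemma exists_le_mul_pow_of_antitone {Φ : ℕ → ℝ} {lam : ℝ} {T k₀ : ℕ} (hΦ : Antitone Φ)
    (h0 : ∀ k, 0 ≤ Φ k) (hl0 : 0 < lam) (hl1 : lam < 1) (hT : 0 < T)
    (hc : ∀ m, k₀ ≤ m → Φ (m + T) ≤ lam ^ T * Φ m) :
    ∃ M, 0 ≤ M ∧ ∀ k, Φ k ≤ M * lam ^ k := by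
  refine ⟨Φ 0 / lam ^ (k₀ + T), div_nonneg (h0 0) (by positivity), fun k => ?_⟩
  induction k using Nat.strong_induction_on with
  | _ k ih =>
    rcases lt_or_ge k (k₀ + T) with hk | hk
    · have h1 : lam ^ (k₀ + T) ≤ lam ^ k := pow_le_pow_of_le_one hl0.le hl1.le hk.le
      calc Φ k ≤ Φ 0 := hΦ (Nat.zero_le k)
        _ = Φ 0 / lam ^ (k₀ + T) * lam ^ (k₀ + T) := by field_simp
        _ ≤ _ := mul_le_mul_of_nonneg_left h1 (div_nonneg (h0 0) (by positivity))
    · obtain ⟨m, rfl⟩ : ∃ m, k = m + T := ⟨k - T, by omega⟩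
      calc Φ (m + T) ≤ lam ^ T * Φ m := hc m (by omega)
        _ ≤ lam ^ T * (Φ 0 / lam ^ (k₀ + T) * lam ^ m) :=
            mul_le_mul_of_nonneg_left (ih m (by omega)) (by positivity)
        _ = _ := by rw [pow_add lam m T]; ring

/-- The delay-weighted sum `∑ j < D, (j + 1) q (k + j)`. Here `q (k + D)` stands for the squared
length of the step at time `k`, so that no negative times occur. -/
def delayEnergy (D : ℕ) (q : ℕ → ℝ) (k : ℕ) : ℝ :=
  ∑ j ∈ Finset.range D, ((j : ℝ) + 1) * q (k + j)

lemma delayEnergy_nonneg {D : ℕ} {q : ℕ → ℝ} (hq : ∀ k, 0 ≤ q k) (k : ℕ) :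
    0 ≤ delayEnergy D q k :=
  Finset.sum_nonneg fun j _ => mul_nonneg (by positivity) (hq _)

lemma delayEnergy_succ (D : ℕ) (q : ℕ → ℝ) (k : ℕ) :
    delayEnergy D q (k + 1) =
      delayEnergy D q k + (D + 1) * q (k + D) - ∑ j ∈ Finset.range (D + 1), q (k + j) := by
  have h1 : ∑ j ∈ Finset.range (D + 1), (j : ℝ) * q (k + j) = delayEnergy D q (k + 1) := by
    rw [Finset.sum_range_succ', delayEnergy]
    simp [add_assoc, add_comm 1]
  have h2 : ∑ j ∈ Finset.range (D + 1), (j : ℝ) * q (k + j) =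
      ∑ j ∈ Finset.range (D + 1), ((j : ℝ) + 1) * q (k + j)
        - ∑ j ∈ Finset.range (D + 1), q (k + j) := by
    rw [← Finset.sum_sub_distrib]
    exact Finset.sum_congr rfl fun j _ => by ring
  rw [← h1, h2, Finset.sum_range_succ, delayEnergy]

section Lyapunov

variable {D : ℕ} {v q : ℕ → ℝ} {p b : ℝ}

/-- The energy obtained by adding the weighted past steps decreases, although the values `v`
themselves need not. -/
lemma energy_succ_le (hq : ∀ k, 0 ≤ q k) (hbp : b * (D + 1) ≤ p / 2) {k : ℕ}
    (h1 : v (k + 1) ≤ v k - p * q (k + D) + b * ∑ j ∈ Finset.range (D + 1), q (k + j)) :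
    v (k + 1) + b * delayEnergy D q (k + 1) ≤
      v k + b * delayEnergy D q k - p / 2 * q (k + D) := by
  rw [delayEnergy_succ]
  have h2 := mul_le_mul_of_nonneg_right hbp (hq (k + D))
  nlinarith

lemma energy_add_sum_le (hq : ∀ k, 0 ≤ q k) (hbp : b * (D + 1) ≤ p / 2)
    (h1 : ∀ k, v (k + 1) ≤ v k - p * q (k + D) + b * ∑ j ∈ Finset.range (D + 1), q (k + j))
    (m n : ℕ) :
    v (m + n) + b * delayEnergy D q (m + n) + p / 2 * ∑ j ∈ Finset.range n, q (m + D + j) ≤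
      v m + b * delayEnergy D q m := by
  induction n with
  | zero => simp
  | succ n ih =>
    have := energy_succ_le hq hbp (h1 (m + n))
    rw [Finset.sum_range_succ, ← add_assoc m n 1, add_right_comm m D n]
    linarith

/-- Descent with delayed errors, together with a contraction over `B` steps up to squared step
lengths, gives linear convergence. -/
theorem linear_rate_of_delayed_descent {B k₀ : ℕ} {γ C C' lam : ℝ} (hq : ∀ k, 0 ≤ q k)
    (hq0 : ∀ k < D, q k = 0) (hB : 0 < B) (hγ1 : γ ≤ 1) (hp : 0 < p) (hb : 0 ≤ b)
    (hC : 0 ≤ C) (hbp : b * (D + 1) ≤ p / 2)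
    (h1 : ∀ k, v (k + 1) ≤ v k - p * q (k + D) + b * ∑ j ∈ Finset.range (D + 1), q (k + j))
    (h2 : ∀ k, k₀ ≤ k →
      v (k + B) ≤ (1 - γ) * v k + C * ∑ j ∈ Finset.range (D + B), q (k + j))
    (h3 : ∀ k, k₀ ≤ k → -(C' * ∑ j ∈ Finset.range (D + B), q (k + j)) ≤ v k)
    (hlim : Tendsto q atTop (𝓝 0)) (hl0 : 0 < lam) (hl1 : lam < 1)
    (hlam : 1 - γ / (1 + (C + b * D) * (2 / p)) ≤ lam ^ (D + B)) :
    ∃ M, 0 ≤ M ∧ ∀ k, |v k| ≤ M * lam ^ k ∧ q (k + D) ≤ M * lam ^ k := by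
  set Φ : ℕ → ℝ := fun k => v k + b * delayEnergy D q k with hΦ
  set A : ℝ := (C + b * D) * (2 / p) with hA
  have hA0 : 0 ≤ A := by positivity
  have hΨ := delayEnergy_nonneg (D := D) hq
  have hstep : ∀ k, Φ (k + 1) ≤ Φ k - p / 2 * q (k + D) := fun k => energy_succ_le hq hbp (h1 k)
  have hanti : Antitone Φ := antitone_nat_of_succ_le fun k => by
    have := hstep k
    have := mul_nonneg (half_pos hp).le (hq (k + D))
    linarith
  have hsum0 : Tendsto (fun k => -(C' * ∑ j ∈ Finset.range (D + B), q (k + j))) atTop (𝓝 0) := by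
    have : Tendsto (fun k => ∑ j ∈ Finset.range (D + B), q (k + j)) atTop
        (𝓝 (∑ _j ∈ Finset.range (D + B), (0 : ℝ))) :=
      tendsto_finsetSum _ fun j _ => hlim.comp (tendsto_add_atTop_nat j)
    simpa using (this.const_mul C').neg
  have hΦ0 : ∀ k, 0 ≤ Φ k := fun k => by
    refine le_of_tendsto hsum0 ?_
    filter_upwards [eventually_ge_atTop (max k k₀)] with n hn
    have ha := h3 n (le_trans (le_max_right _ _) hn)
    have hb' : Φ n ≤ Φ k := hanti (le_trans (le_max_left _ _) hn)
    have hc : v n ≤ Φ n := le_add_of_nonneg_right (mul_nonneg hb (hΨ n))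
    linarith
  have hcontr : ∀ m, k₀ ≤ m → Φ (m + (D + B)) ≤ lam ^ (D + B) * Φ m := fun m hm => by
    set Q : ℝ := ∑ j ∈ Finset.range (D + B), q (m + D + j) with hQ
    have hQle : Q ≤ 2 / p * (Φ m - Φ (m + (D + B))) := by
      have := energy_add_sum_le hq hbp h1 m (D + B)
      rw [div_mul_eq_mul_div, le_div_iff₀ hp]
      simp only [hΦ]
      linarith
    have hΨle : delayEnergy D q (m + D + B) ≤ D * Q := by
      have ha : delayEnergy D q (m + D + B) ≤
          ∑ j ∈ Finset.range D, (D : ℝ) * q (m + D + (B + j)) := by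
        refine Finset.sum_le_sum fun j hj => ?_
        rw [add_assoc (m + D) B j]
        refine mul_le_mul_of_nonneg_right ?_ (hq _)
        exact_mod_cast Finset.mem_range.1 hj
      have hb' : ∑ j ∈ Finset.range D, q (m + D + (B + j)) ≤ Q := by
        rw [hQ, add_comm D B, Finset.sum_range_add]
        exact le_add_of_nonneg_left (Finset.sum_nonneg fun _ _ => hq _)
      rw [← Finset.mul_sum] at ha
      exact ha.trans (mul_le_mul_of_nonneg_left hb' (Nat.cast_nonneg D))
    have hv := h2 (m + D) (by omega)
    have hvΦ : v (m + D) ≤ Φ m :=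
      (le_add_of_nonneg_right (mul_nonneg hb (hΨ _))).trans (hanti (Nat.le_add_right m D))
    have hmain : Φ (m + (D + B)) ≤ (1 - γ) * Φ m + (C + b * D) * Q := by
      rw [← add_assoc]
      have e1 := mul_le_mul_of_nonneg_left hvΦ (by linarith : 0 ≤ 1 - γ)
      have e2 := mul_le_mul_of_nonneg_left hΨle hb
      simp only [hΦ] at e1 ⊢
      linarith
    have hA' : (C + b * D) * Q ≤ A * (Φ m - Φ (m + (D + B))) := by
      rw [hA, mul_assoc]
      exact mul_le_mul_of_nonneg_left hQle (by positivity)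
    have hθ : Φ (m + (D + B)) ≤ (1 - γ / (1 + A)) * Φ m := by
      have : (1 - γ / (1 + A)) * Φ m = ((1 - γ + A) * Φ m) / (1 + A) := by
        field_simp
        ring
      rw [this, le_div_iff₀ (by linarith)]
      linarith
    exact hθ.trans (mul_le_mul_of_nonneg_right hlam (hΦ0 m))
  obtain ⟨M, hM, hΦM⟩ := exists_le_mul_pow_of_antitone hanti hΦ0 hl0 hl1 (by omega) hcontr
  have hqD : ∀ k, q (k + D) ≤ 2 / p * M * lam ^ k := fun k => by
    have ha := hstep k
    have hb' := hΦ0 (k + 1)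
    have hc := hΦM k
    rw [mul_assoc, div_mul_eq_mul_div, le_div_iff₀ hp]
    linarith
  set M' := 2 / p * M * (lam ^ D)⁻¹ with hM'
  have hM'0 : 0 ≤ M' := by positivity
  have hqk : ∀ k, q k ≤ M' * lam ^ k := fun k => by
    rcases lt_or_ge k D with hk | hk
    · rw [hq0 k hk]
      positivity
    · obtain ⟨m, rfl⟩ : ∃ m, k = m + D := ⟨k - D, by omega⟩
      refine (hqD m).trans (le_of_eq ?_)
      rw [hM', pow_add]
      field_simp
  have hΨk : ∀ k, delayEnergy D q k ≤ (∑ j ∈ Finset.range D, ((j : ℝ) + 1)) * M' * lam ^ k :=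
    fun k => by
    rw [delayEnergy, Finset.sum_mul, Finset.sum_mul]
    refine Finset.sum_le_sum fun j _ => ?_
    rw [mul_assoc]
    refine mul_le_mul_of_nonneg_left ((hqk (k + j)).trans ?_) (by positivity)
    exact mul_le_mul_of_nonneg_left
      (pow_le_pow_of_le_one hl0.le hl1.le (Nat.le_add_right k j)) hM'0
  set S : ℝ := (∑ j ∈ Finset.range D, ((j : ℝ) + 1)) with hS
  have hS0 : 0 ≤ S := Finset.sum_nonneg fun _ _ => by positivity
  refine ⟨M + 2 / p * M + b * (S * M'), by positivity, fun k => ⟨?_, ?_⟩⟩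
  · have hpow : 0 ≤ lam ^ k := by positivity
    have ha := hΦM k
    have hb' := hΦ0 k
    have hc := mul_le_mul_of_nonneg_left (hΨk k) hb
    have hd := mul_nonneg hb (hΨ k)
    have he : 0 ≤ M * lam ^ k := by positivity
    have hf : 0 ≤ 2 / p * M * lam ^ k := by positivity
    have hg : 0 ≤ b * (S * M' * lam ^ k) := by positivity
    simp only [hΦ] at ha hb'
    rw [abs_le]
    constructor <;> linarith
  · refine (hqD k).trans (mul_le_mul_of_nonneg_right ?_ (by positivity))
    have : 0 ≤ b * (S * M') := by positivity
    linarith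

end Lyapunov

/-! ### Block vectors and the gradient of the smooth part -/

section PiLp

variable {ι : Type*} [Fintype ι] {β : ι → Type*} [∀ i, NormedAddCommGroup (β i)]

lemma PiLp.norm_le_sum_norm (x : PiLp 2 β) : ‖x‖ ≤ ∑ i, ‖x i‖ := by
  have h0 : 0 ≤ ∑ i, ‖x i‖ := Finset.sum_nonneg fun _ _ => norm_nonneg _
  refine le_of_sq_le_sq ?_ h0
  rw [PiLp.norm_sq_eq_of_L2]
  exact Finset.sum_sq_le_sq_sum_of_nonneg fun _ _ => norm_nonneg _

lemma PiLp.norm_le_card_mul {x : PiLp 2 β} {b : ℝ} {n : ℕ} (hn : Fintype.card ι ≤ n) (hb : 0 ≤ b)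
    (h : ∀ i, ‖x i‖ ≤ b) : ‖x‖ ≤ n * b := by
  refine (PiLp.norm_le_sum_norm x).trans ((Finset.sum_le_card_nsmul _ _ b fun i _ => h i).trans ?_)
  rw [nsmul_eq_mul, Finset.card_univ]
  exact mul_le_mul_of_nonneg_right (by exact_mod_cast hn) hb

end PiLp

namespace PartitionedProblem

variable {N : ℕ} {P : PartitionedProblem N}

lemma norm_vec_le {x : P.Vec} {b : ℝ} (hb : 0 ≤ b) (h : ∀ i, ‖x i‖ ≤ b) : ‖x‖ ≤ N * b :=
  PiLp.norm_le_card_mul (by simp) hb h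

lemma norm_nbVec_le {j : Fin N} {y : P.NbVec j} {b : ℝ} (hb : 0 ≤ b) (h : ∀ l, ‖y l‖ ≤ b) :
    ‖y‖ ≤ N * b :=
  PiLp.norm_le_card_mul ((Fintype.card_subtype_le _).trans (by simp)) hb h

lemma norm_restr_sub_restr_le {x y : P.Vec} {b : ℝ} (hb : 0 ≤ b) (h : ∀ i, ‖x i - y i‖ ≤ b)
    (j : Fin N) : ‖P.restr j x - P.restr j y‖ ≤ N * b :=
  norm_nbVec_le hb fun l => h l.1

lemma restr_mem_feasNb {x : P.Vec} (hx : x ∈ P.feas) (i : Fin N) : P.restr i x ∈ P.feasNb i :=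
  fun j => hx j.1

/-- The vector `x` with block `i` replaced by `z`. -/
def replaceBlock (x : P.Vec) (i : Fin N) (z : P.Blk i) : P.Vec :=
  WithLp.toLp 2 (Function.update (WithLp.ofLp x) i z)

@[simp] lemma replaceBlock_same (x : P.Vec) (i : Fin N) (z : P.Blk i) :
    replaceBlock x i z i = z := by
  simp [replaceBlock]

lemma replaceBlock_of_ne (x : P.Vec) {i l : Fin N} (z : P.Blk i) (h : l ≠ i) :
    replaceBlock x i z l = x l := by
  simp [replaceBlock, h]

lemma replaceBlock_mem_feas {x : P.Vec} (hx : x ∈ P.feas) {i : Fin N} {z : P.Blk i}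
    (hz : z ∈ P.X i) : replaceBlock x i z ∈ P.feas := fun l => by
  by_cases h : l = i
  · subst h
    simpa using hz
  · rw [replaceBlock_of_ne _ _ h]
    exact hx l

lemma norm_replaceBlock_sub_apply_le (x : P.Vec) (i : Fin N) (z : P.Blk i) (l : Fin N) :
    ‖replaceBlock x i z l - x l‖ ≤ ‖z - x i‖ := by
  by_cases h : l = i
  · subst h
    simp
  · simp [replaceBlock_of_ne _ _ h]

lemma norm_replaceBlock_sub_le (x : P.Vec) (i : Fin N) (z : P.Blk i) :
    ‖replaceBlock x i z - x‖ ≤ ‖z - x i‖ := by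
  refine (PiLp.norm_le_sum_norm _).trans (le_of_eq ?_)
  rw [Finset.sum_eq_single i]
  · simp
  · intro l _ hl
    simp [replaceBlock_of_ne _ _ hl]
  · simp

lemma inner_replaceBlock_sub (u x : P.Vec) (i : Fin N) (z : P.Blk i) :
    inner ℝ u (replaceBlock x i z - x) = inner ℝ (u i) (z - x i) := by
  rw [PiLp.inner_apply, Finset.sum_eq_single i]
  · simp
  · intro l _ hl
    simp [replaceBlock_of_ne _ _ hl]
  · simp

lemma pgrad_of_notMem {j i : Fin N} (h : i ∉ P.Nb j) (y : P.NbVec j) : P.pgrad j i y = 0 := by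
  simp [pgrad, h]

/-- The vector of all sums of partial gradients; at feasible points it is the gradient of `F`. -/
def gradF (x : P.Vec) : P.Vec := WithLp.toLp 2 fun i => ∑ j, P.pgrad j i (P.restr j x)

lemma gradF_apply (x : P.Vec) (i : Fin N) :
    gradF x i = ∑ j, P.pgrad j i (P.restr j x) := rfl

lemma gradF_apply_eq_sum_Nb (x : P.Vec) (i : Fin N) :
    gradF x i = ∑ j ∈ P.Nb i, P.pgrad j i (P.restr j x) :=
  (Finset.sum_subset (Finset.subset_univ _) fun j _ hj =>
    pgrad_of_notMem (fun h => hj (P.symm j i h)) _).symm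

lemma sum_pgrad_eq (i : Fin N) (w : ∀ j, P.NbVec j) :
    ∑ j, P.pgrad j i (w j) = P.pgrad i i (w i) + ∑ j ∈ (P.Nb i).erase i, P.pgrad j i (w j) := by
  rw [Finset.add_sum_erase _ (fun j => P.pgrad j i (w j)) (P.self_mem i)]
  refine (Finset.sum_subset (Finset.subset_univ _) fun j _ hj => ?_).symm
  exact pgrad_of_notMem (fun h => hj (P.symm j i h)) _

lemma SmoothF.differentiableAt (h : P.SmoothF) {i : Fin N} {y : P.NbVec i}
    (hy : y ∈ P.feasNb i) : DifferentiableAt ℝ (P.f i) y := by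
  obtain ⟨U, hU, hsub, hc⟩ := h i
  exact (hc.contDiffAt (hU.mem_nhds (hsub hy))).differentiableAt one_ne_zero

/-- The restriction to the blocks of a neighbourhood, as a continuous linear map. -/
def restrCLM (i : Fin N) : P.Vec →L[ℝ] P.NbVec i :=
  LinearMap.toContinuousLinearMap
    { toFun := P.restr i
      map_add' := fun _ _ => rfl
      map_smul' := fun _ _ => rfl }

@[simp] lemma restrCLM_apply (i : Fin N) (x : P.Vec) : restrCLM i x = P.restr i x := rfl

lemma inner_gradient_restr (i : Fin N) (y : P.NbVec i) (d : P.Vec) :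
    inner ℝ (gradient (P.f i) y) (P.restr i d) = ∑ j, inner ℝ (P.pgrad i j y) (d j) := by
  rw [PiLp.inner_apply]
  have h1 : ∀ l : {j // j ∈ P.Nb i}, inner ℝ (gradient (P.f i) y l) (P.restr i d l) =
      inner ℝ (P.pgrad i l.1 y) (d l.1) := fun l => by
    rw [pgrad, dif_pos l.2]
    rfl
  rw [Finset.sum_congr rfl fun l _ => h1 l]
  refine (Finset.sum_coe_sort (P.Nb i) (fun j => inner ℝ (P.pgrad i j y) (d j))).trans ?_
  refine Finset.sum_subset (Finset.subset_univ _) fun j _ hj => ?_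
  rw [pgrad_of_notMem hj, inner_zero_left]

lemma SmoothF.hasGradientAt (h : P.SmoothF) {x : P.Vec} (hx : x ∈ P.feas) :
    HasGradientAt P.F (gradF x) x := by
  rw [hasGradientAt_iff_hasFDerivAt]
  have h1 : ∀ i ∈ Finset.univ, HasFDerivAt (fun x => P.f i (P.restr i x))
      ((InnerProductSpace.toDual ℝ _ (gradient (P.f i) (P.restr i x))).comp (restrCLM i)) x := by
    intro i _
    have hf := (h.differentiableAt (restr_mem_feasNb hx i)).hasGradientAt.hasFDerivAt
    exact HasFDerivAt.comp x (f := restrCLM i) hf (restrCLM i).hasFDerivAt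
  refine (HasFDerivAt.fun_sum h1).congr_fderiv (ContinuousLinearMap.ext fun d => ?_)
  rw [sum_apply]
  simp only [ContinuousLinearMap.comp_apply, InnerProductSpace.toDual_apply_apply, restrCLM_apply,
    inner_gradient_restr]
  rw [Finset.sum_comm, PiLp.inner_apply]
  exact Finset.sum_congr rfl fun i _ => by rw [gradF_apply, sum_inner]

lemma SmoothF.gradient_F (h : P.SmoothF) {x : P.Vec} (hx : x ∈ P.feas) :
    gradient P.F x = gradF x :=
  (h.hasGradientAt hx).gradient

lemma AssumptionA.smoothF {x0 : P.Vec} (h : P.AssumptionA x0) : P.SmoothF := by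
  rcases h.smooth with h | ⟨K, h⟩
  · exact h.2.1
  · exact h.1

lemma AssumptionA.continuousOn_pgrad {x0 : P.Vec} (h : P.AssumptionA x0) (i j : Fin N) :
    ContinuousOn (P.pgrad i j) (P.feasNb i) := by
  by_cases hj : j ∈ P.Nb i
  · rcases h.smooth with h | ⟨K, h⟩
    · exact (h.2.2 i j hj).continuousOn
    · exact (h.2 i j hj).continuousOn
  · have : P.pgrad i j = fun _ => 0 := funext fun y => pgrad_of_notMem hj y
    rw [this]
    exact continuousOn_const

lemma AssumptionA.continuousOn_gradF {x0 : P.Vec} (h : P.AssumptionA x0) :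
    ContinuousOn (gradF : P.Vec → P.Vec) P.feas := by
  refine (PiLp.continuous_toLp 2 _).comp_continuousOn (continuousOn_pi.2 fun i => ?_)
  refine continuousOn_finsetSum _ fun j _ => ?_
  exact (h.continuousOn_pgrad j i).comp (restrCLM j).continuous.continuousOn
    fun x hx => restr_mem_feasNb hx j

lemma AssumptionA.isClosed_feas {x0 : P.Vec} (h : P.AssumptionA x0) : IsClosed P.feas := by
  have : P.feas = ⋂ i, (fun x : P.Vec => x i) ⁻¹' P.X i := by
    ext x
    simp [feas]
  rw [this]
  exact isClosed_iInter fun i => (h.closed i).preimage (PiLp.continuous_apply 2 _ i)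

lemma AssumptionA.convex_feas {x0 : P.Vec} (h : P.AssumptionA x0) : Convex ℝ P.feas :=
  fun _ hx _ hy _ _ ha hb hab i => h.convex i (hx i) (hy i) ha hb hab

lemma AssumptionA.convexOn_G {x0 : P.Vec} (h : P.AssumptionA x0) : ConvexOn ℝ P.feas P.G := by
  refine ⟨h.convex_feas, fun x hx y hy a b ha hb hab => ?_⟩
  rw [G, G, G, Finset.smul_sum, Finset.smul_sum, ← Finset.sum_add_distrib]
  exact Finset.sum_le_sum fun i _ => (h.g_convex i).2 (hx i) (hy i) ha hb hab

lemma AssumptionA.lowerSemicontinuousOn_G {x0 : P.Vec} (h : P.AssumptionA x0) :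
    LowerSemicontinuousOn P.G P.feas := by
  refine lowerSemicontinuousOn_sum fun i _ => ?_
  intro x hx y hy
  have hc : ContinuousWithinAt (fun x : P.Vec => x i) P.feas x :=
    (PiLp.continuous_apply 2 _ i).continuousWithinAt
  exact (hc.tendsto_nhdsWithin fun z hz => hz i).eventually (h.g_lsc i (x i) (hx i) y hy)

/-! ### Stationary points and the proximal map -/

lemma mem_stat_iff {x : P.Vec} (h : P.SmoothF) : x ∈ P.stat ↔ x ∈ P.feas ∧
    ∀ y ∈ P.feas, 0 ≤ inner ℝ (gradF x) (y - x) + P.G y - P.G x := by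
  refine and_congr_right fun hx => ?_
  rw [h.gradient_F hx]

/-- The minimizers of the objective are stationary. -/
lemma AssumptionA.stat_nonempty {x0 : P.Vec} (h : P.AssumptionA x0) : P.stat.Nonempty := by
  obtain ⟨x, hx, hmin⟩ := h.solvable
  exact ⟨x, (mem_stat_iff h.smoothF).2 ⟨hx, fun y hy =>
    variational_inequality_of_forall_le h.convexOn_G (h.smoothF.hasGradientAt hx) hx hmin hy⟩⟩

lemma AssumptionA.exists_isProx {x0 : P.Vec} (h : P.AssumptionA x0) (z : P.Vec) :
    ∃ p, P.IsProx z p :=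
  h.convexOn_G.exists_prox h.isClosed_feas h.lowerSemicontinuousOn_G
    ⟨h.stat_nonempty.some, h.stat_nonempty.some_mem.1⟩ z

lemma IsProx.variational_inequality {x0 z p y : P.Vec} (h : P.AssumptionA x0) (hp : P.IsProx z p)
    (hy : y ∈ P.feas) : 0 ≤ inner ℝ (p - z) (y - p) + P.G y - P.G p := by
  refine variational_inequality_of_forall_le (φ := fun u => ‖u - z‖ ^ 2 / 2) h.convexOn_G ?_ hp.1
    (fun u hu => by linarith [hp.2 u hu]) hy
  rw [hasGradientAt_iff_hasFDerivAt]
  have h1 := (((hasFDerivAt_id p).sub_const z).norm_sq).mul_const (2⁻¹ : ℝ)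
  simp only [id, ← div_eq_mul_inv] at h1
  refine h1.congr_fderiv (ContinuousLinearMap.ext fun u => ?_)
  simp [InnerProductSpace.toDual_apply_apply]

/-- Limits of stationary points are stationary. -/
lemma AssumptionA.isClosed_stat {x0 : P.Vec} (h : P.AssumptionA x0) : IsClosed P.stat := by
  refine isClosed_of_closure_subset fun x hx => ?_
  obtain ⟨u, hu, hlim⟩ := mem_closure_iff_seq_limit.1 hx
  have hxf : x ∈ P.feas := h.isClosed_feas.mem_of_tendsto hlim
    (Eventually.of_forall fun n => (hu n).1)
  have hlimW : Tendsto u atTop (𝓝[P.feas] x) :=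
    tendsto_nhdsWithin_iff.2 ⟨hlim, Eventually.of_forall fun n => (hu n).1⟩
  refine (mem_stat_iff h.smoothF).2 ⟨hxf, fun y hy => ?_⟩
  have hgrad : Tendsto (fun n => inner ℝ (gradF (u n)) (y - u n)) atTop
      (𝓝 (inner ℝ (gradF x) (y - x))) :=
    ((h.continuousOn_gradF x hxf).tendsto.comp hlimW).inner (hlim.const_sub y)
  by_contra hneg
  push Not at hneg
  obtain ⟨c, hc1, hc2⟩ := exists_between hneg
  have e1 : ∀ᶠ n in atTop, inner ℝ (gradF (u n)) (y - u n) <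
      inner ℝ (gradF x) (y - x) - c / 2 := hgrad.eventually_lt_const (by linarith)
  have e2 : ∀ᶠ n in atTop, P.G x + c / 2 < P.G (u n) :=
    hlimW.eventually (h.lowerSemicontinuousOn_G x hxf _ (by linarith))
  obtain ⟨n, hn1, hn2⟩ := (e1.and e2).exists
  have := ((mem_stat_iff h.smoothF).1 (hu n)).2 y hy
  linarith

/-- Under the error bound, every feasible point has a stationary point at distance at most
`2 κ ‖x - p‖`; the factor `2` makes up for not having a projection onto the stationary set. -/
lemma ErrorBound.exists_mem_stat {x0 x p : P.Vec} {η ε κ : ℝ} (hA : P.AssumptionA x0)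
    (h : P.ErrorBound η ε κ) (hκ : 0 < κ) (hx : x ∈ P.feas) (hV : P.V x ≤ η)
    (hp : P.IsProx (x - gradF x) p) (hr : ‖x - p‖ ≤ ε) :
    ∃ y ∈ P.stat, ‖x - y‖ ≤ 2 * κ * ‖x - p‖ := by
  have hd : Metric.infDist x P.stat ≤ κ * ‖x - p‖ :=
    h x hx hV p (by rwa [hA.smoothF.gradient_F hx]) hr
  rcases (norm_nonneg (x - p)).eq_or_lt with h0 | h0
  · rw [← h0, mul_zero] at hd
    have : x ∈ closure P.stat := (Metric.mem_closure_iff_infDist_zero hA.stat_nonempty).2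
      (le_antisymm hd Metric.infDist_nonneg)
    exact ⟨x, hA.isClosed_stat.closure_subset this, by simp [← h0]⟩
  · obtain ⟨y, hy, hlt⟩ := (Metric.infDist_lt_iff hA.stat_nonempty (x := x)
      (r := 2 * κ * ‖x - p‖)).1 (by nlinarith [mul_pos hκ h0])
    exact ⟨y, hy, by rw [← dist_eq_norm]; exact hlt.le⟩

end PartitionedProblem

/-! ### Best responses and the existence of an admissible constant -/

namespace PartitionedProblem

variable {N : ℕ} {P : PartitionedProblem N} {s : P.Surrogates} {τ : ℝ} {Li : Fin N → ℝ≥0}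
  {x0 : P.Vec}

/-- The gradient at `z` of the smooth part of the function that a best response with information `w`
minimizes. -/
def respGrad (s : P.Surrogates) (i : Fin N) (w : ∀ j, P.NbVec j) (z : P.Blk i) : P.Blk i :=
  gradient (fun u => s i u (w i)) z + ∑ j ∈ (P.Nb i).erase i, P.pgrad j i (w j)

lemma AssumptionC.hasGradientAt (hC : AssumptionC s τ Li) {i : Fin N} {y : P.NbVec i}
    (hy : y ∈ P.feasNb i) {z : P.Blk i} (hz : z ∈ P.X i) :
    HasGradientAt (fun u => s i u y) (gradient (fun u => s i u y) z) z := by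
  obtain ⟨U, hU, hsub, hc⟩ := hC.smooth i y hy
  exact ((hc.contDiffAt (hU.mem_nhds (hsub hz))).differentiableAt one_ne_zero).hasGradientAt

lemma IsBestResponse.variational_inequality (hA : P.AssumptionA x0) (hC : AssumptionC s τ Li)
    {i : Fin N} {w : ∀ j, P.NbVec j} {v z u : P.Blk i} (h : IsBestResponse s i w v z)
    (hw : w i ∈ P.feasNb i) (hu : u ∈ P.X i) :
    0 ≤ inner ℝ (respGrad s i w z) (u - z) + P.g i u - P.g i z := by
  set c := ∑ j ∈ (P.Nb i).erase i, P.pgrad j i (w j) with hc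
  have hsum : ∀ u, ∑ j ∈ (P.Nb i).erase i, inner ℝ (P.pgrad j i (w j)) (u - v) =
      inner ℝ c (u - v) := fun u => by rw [hc, sum_inner]
  refine variational_inequality_of_forall_le (φ := fun u => s i u (w i) + inner ℝ c (u - v))
    (hA.g_convex i) ?_ h.1 (fun u hu => ?_) hu
  · have h1 := (hC.hasGradientAt hw h.1).hasFDerivAt
    have h2 := (InnerProductSpace.toDual ℝ _ c).hasFDerivAt.comp z
      ((hasFDerivAt_id z).sub_const v)
    rw [hasGradientAt_iff_hasFDerivAt]
    refine (h1.add h2).congr_fderiv (ContinuousLinearMap.ext fun d => ?_)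
    simp [respGrad, InnerProductSpace.toDual_apply_apply, hc]
  · have := h.2 u hu
    rwa [hsum, hsum] at this

lemma AssumptionC.respGrad_strongMono (hC : AssumptionC s τ Li) {i : Fin N}
    {w : ∀ j, P.NbVec j} (hw : w i ∈ P.feasNb i) {z u : P.Blk i} (hz : z ∈ P.X i)
    (hu : u ∈ P.X i) :
    τ * ‖z - u‖ ^ 2 ≤ inner ℝ (respGrad s i w z - respGrad s i w u) (z - u) := by
  rw [respGrad, respGrad, add_sub_add_right_eq_sub]
  exact (hC.strong_convex i _ hw).mul_norm_sq_le_inner hz hu (hC.hasGradientAt hw hz)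
    (hC.hasGradientAt hw hu)

/-- Optimality of the best response `z` against a competitor `u`, sharpened by strong convexity. -/
lemma IsBestResponse.g_sub_le (hA : P.AssumptionA x0) (hC : AssumptionC s τ Li)
    {i : Fin N} {w : ∀ j, P.NbVec j} {v z u : P.Blk i} (h : IsBestResponse s i w v z)
    (hw : w i ∈ P.feasNb i) (hu : u ∈ P.X i) :
    P.g i z - P.g i u ≤ -(τ * ‖z - u‖ ^ 2) - inner ℝ (respGrad s i w u) (z - u) := by
  have h1 := h.variational_inequality hA hC hw hu
  have h2 := hC.respGrad_strongMono hw h.1 hu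
  rw [← neg_sub z u, inner_neg_right] at h1
  rw [inner_sub_left] at h2
  linarith

lemma norm_le_of_mem_cube {U : ℝ} {w : P.Vec} (hw : w ∈ P.cube U) (i : Fin N) :
    ‖w i‖ ≤ (P.n i : ℝ) * |U| :=
  PiLp.norm_le_card_mul (by simp) (abs_nonneg U) fun c =>
    (Real.norm_eq_abs _).le.trans ((hw.2 i c).trans (le_abs_self U))

lemma AssumptionA.isCompact_cube (hA : P.AssumptionA x0) (U : ℝ) : IsCompact (P.cube U) := by
  refine Metric.isCompact_of_isClosed_isBounded ?_ ?_
  · have : P.cube U = P.feas ∩ ⋂ i, ⋂ c, (fun x : P.Vec => |x i c|) ⁻¹' Set.Iic U := by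
      ext x
      simp [cube]
    rw [this]
    refine hA.isClosed_feas.inter (isClosed_iInter fun i => isClosed_iInter fun c => ?_)
    exact isClosed_Iic.preimage
      ((PiLp.continuous_apply 2 _ c).comp (PiLp.continuous_apply 2 _ i)).abs
  · refine (Metric.isBounded_iff_subset_closedBall 0).2 ⟨∑ i, (P.n i : ℝ) * |U|, fun x hx => ?_⟩
    rw [mem_closedBall_zero_iff]
    exact (PiLp.norm_le_sum_norm x).trans (Finset.sum_le_sum fun i _ => norm_le_of_mem_cube hx i)

lemma wideCube_subset_cube (U ψ : ℝ) : P.wideCube U ψ ⊆ P.cube (U + ψ) := by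
  rintro x ⟨hx, w, hw, hxw⟩
  refine ⟨hx, fun i c => ?_⟩
  have h1 : |x i c - w i c| ≤ ‖x i - w i‖ := by
    simpa using PiLp.norm_apply_le (x i - w i) c
  have h2 : |x i c| ≤ |w i c| + |x i c - w i c| := by
    simpa using abs_add_le (w i c) (x i c - w i c)
  linarith [hw.2 i c, hxw i]

lemma exists_cube_of_isCompact {S : Set P.Vec} (hS : IsCompact S) (hf : S ⊆ P.feas) :
    ∃ U, S ⊆ P.cube U := by
  obtain ⟨R, hR⟩ := hS.isBounded.exists_norm_le
  refine ⟨R, fun x hx => ⟨hf hx, fun i c => ?_⟩⟩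
  have h1 : |x i c| ≤ ‖x i‖ := by simpa using PiLp.norm_apply_le (x i) c
  exact h1.trans ((PiLp.norm_apply_le x i).trans (hR x hx))

/-- The best responses to information from a compact set are at bounded distance from a fixed point:
strong convexity beats the linear lower bound of the convex part. -/
lemma exists_bound_bestResponse (hA : P.AssumptionA x0) (hC : AssumptionC s τ Li) (U : ℝ)
    (i : Fin N) :
    ∃ ψ, ∀ w : Fin N → P.Vec, (∀ j, w j ∈ P.cube U) → ∀ z,
      IsBestResponse s i (fun j => P.restr j (w j)) (w i i) z → ‖z - w i i‖ ≤ ψ := by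
  obtain ⟨u₀, hu₀⟩ := hA.nonempty i
  obtain ⟨C, hC0, hlow⟩ := (hA.g_convex i).exists_linear_lower_bound (hA.closed i) (hA.g_lsc i) hu₀
  have hb : ∀ j, ∃ Γ, ∀ x ∈ P.cube U, ‖P.pgrad j i (P.restr j x)‖ ≤ Γ := fun j =>
    (hA.isCompact_cube U).exists_bound_of_continuousOn
      ((hA.continuousOn_pgrad j i).comp (restrCLM j).continuous.continuousOn
        fun x hx => restr_mem_feasNb hx.1 j)
  obtain ⟨Γ, hΓ⟩ := Classical.axiom_of_choice hb
  obtain ⟨Γ', hΓ'⟩ := (hA.isCompact_cube U).exists_bound_of_continuousOn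
    ((hC.grad_lipschitz i u₀ hu₀).continuousOn.comp (restrCLM i).continuous.continuousOn
        fun x hx => restr_mem_feasNb hx.1 i)
  set Λ : ℝ := |Γ'| + ∑ j, |Γ j| with hΛ
  have hΛ0 : 0 ≤ Λ := by positivity
  have hτ := hC.tau_pos
  refine ⟨1 + (Λ + 2 * C + |P.g i u₀|) / τ + ‖u₀‖ + P.n i * |U|, fun w hw z hz => ?_⟩
  have hgrad : ‖respGrad s i (fun j => P.restr j (w j)) u₀‖ ≤ Λ := by
    refine (norm_add_le _ _).trans (add_le_add ((hΓ' _ (hw i)).trans (le_abs_self _)) ?_)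
    refine (norm_sum_le _ _).trans ?_
    refine (Finset.sum_le_sum fun j _ => ((hΓ j _ (hw j)).trans (le_abs_self _))).trans ?_
    exact Finset.sum_le_sum_of_subset_of_nonneg (Finset.subset_univ _) fun _ _ _ => abs_nonneg _
  set r := ‖z - u₀‖ with hr
  have hr0 : 0 ≤ r := norm_nonneg _
  have h1 := hz.g_sub_le hA hC (restr_mem_feasNb (hw i).1 i) hu₀
  have h2 := hlow z hz.1
  have h3 : -(Λ * r) ≤ inner ℝ (respGrad s i (fun j => P.restr j (w j)) u₀) (z - u₀) := by
    refine (neg_le_neg ?_).trans (neg_abs_le _)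
    exact (abs_real_inner_le_norm _ _).trans (mul_le_mul_of_nonneg_right hgrad hr0)
  have h4 := le_abs_self (P.g i u₀)
  have ha := abs_nonneg (P.g i u₀)
  have hrle : r ≤ 1 + (Λ + 2 * C + |P.g i u₀|) / τ := by
    rcases le_total r 1 with h | h
    · have : 0 ≤ (Λ + 2 * C + |P.g i u₀|) / τ := by positivity
      linarith
    · have : r ≤ (Λ + 2 * C + |P.g i u₀|) / τ := by
        rw [le_div_iff₀ hτ]
        by_contra hcon
        push Not at hcon
        nlinarith
      linarith
  have h5 : ‖z - w i i‖ ≤ r + (‖u₀‖ + ‖w i i‖) := by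
    have e : z - w i i = (z - u₀) + (u₀ - w i i) := by abel
    rw [e]
    exact (norm_add_le _ _).trans (add_le_add le_rfl (norm_sub_le _ _))
  linarith [norm_le_of_mem_cube (hw i) i]

lemma lipschitzOnWith_pgrad_of_notMem {i j : Fin N} (h : j ∉ P.Nb i) (K : ℝ≥0)
    (A : Set (P.NbVec i)) : LipschitzOnWith K (P.pgrad i j) A := by
  have : P.pgrad i j = fun _ => 0 := funext fun y => pgrad_of_notMem h y
  rw [this]
  exact LipschitzOnWith.of_dist_le_mul fun x _ y _ => by simp; positivity

theorem exists_isLipConst (hA : P.AssumptionA x0) (hC : AssumptionC s τ Li) :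
    ∃ L : ℝ≥0, 0 < L ∧ IsLipConst s x0 L := by
  rcases hA.smooth with h | ⟨K, hK⟩
  · obtain ⟨U, hU⟩ := exists_cube_of_isCompact h.1 fun x hx => hx.1
    obtain ⟨ψ, hψ⟩ := Classical.axiom_of_choice (exists_bound_bestResponse hA hC U)
    set Ψ : ℝ := 1 + ∑ i, |ψ i| with hΨ
    have hK : ∀ i, ∀ j, ∃ K, LipschitzOnWith K (P.pgrad i j) (P.restr i '' P.wideCube U Ψ) := by
      intro i j
      by_cases hj : j ∈ P.Nb i
      · have hcomp : IsCompact (P.restr i '' P.cube (U + Ψ)) :=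
          (hA.isCompact_cube _).image (restrCLM i).continuous
        obtain ⟨K, hK⟩ := ((h.2.2 i j hj).mono (s := P.restr i '' P.cube (U + Ψ))
          (Set.image_subset_iff.2 fun x hx =>
            restr_mem_feasNb hx.1 i)).exists_lipschitzOnWith_of_compact hcomp
        exact ⟨K, hK.mono (Set.image_mono (wideCube_subset_cube U Ψ))⟩
      · exact ⟨0, lipschitzOnWith_pgrad_of_notMem hj _ _⟩
    choose K hK using hK
    refine ⟨1 + ∑ i, ∑ j, K i j, by positivity, Or.inr ⟨h, U, Ψ, by positivity, hU, ?_, ?_⟩⟩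
    · intro i w hw z hz
      refine (hψ i w hw z hz).trans ((le_abs_self _).trans ?_)
      have := Finset.single_le_sum (f := fun i => |ψ i|) (fun j _ => abs_nonneg _)
        (Finset.mem_univ i)
      linarith
    · intro i j _
      refine (hK i j).weaken ?_
      calc K i j ≤ ∑ j, K i j := Finset.single_le_sum (fun _ _ => zero_le) (Finset.mem_univ j)
        _ ≤ ∑ i, ∑ j, K i j :=
          Finset.single_le_sum (f := fun i => ∑ j, K i j) (fun _ _ => zero_le)
            (Finset.mem_univ i)
        _ ≤ _ := le_add_self
  · exact ⟨K + 1, by positivity, Or.inl ⟨hK.1, fun i j hj => (hK.2 i j hj).weaken le_self_add⟩⟩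

/-! ### Sets that confine the iterates -/

/-- What both cases of an admissible constant `L` provide: a set `Q` of product form that contains the
level set of `x0`, and a larger set `W` of feasible points on which the partial gradients are
`L`-Lipschitz and which contains the feasible points near `Q` and those within the length of
a best-response step from `Q`. -/
structure Confinement (s : P.Surrogates) (x0 : P.Vec) (L : ℝ≥0) (Q W : Set P.Vec) : Prop where
  level_subset : P.level x0 ⊆ Q
  subset_feas : W ⊆ P.feas
  subset : Q ⊆ W
  mix : ∀ w : Fin N → P.Vec, (∀ l, w l ∈ Q) → (WithLp.toLp 2 fun l => w l l : P.Vec) ∈ Q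
  near : ∃ ψ > 0, ∀ x ∈ Q, ∀ y ∈ P.feas, (∀ i, ‖y i - x i‖ ≤ ψ) → y ∈ W
  response : ∀ i, ∀ w : Fin N → P.Vec, (∀ j, w j ∈ Q) → ∀ z,
    IsBestResponse s i (fun j => P.restr j (w j)) (w i i) z →
      ∀ x ∈ Q, ∀ y ∈ P.feas, (∀ j, ‖y j - x j‖ ≤ ‖z - w i i‖) → y ∈ W
  lipschitz : ∀ i j, LipschitzOnWith L (P.pgrad i j) (P.restr i '' W)

lemma IsLipConst.exists_confinement {L : ℝ≥0} (h : IsLipConst s x0 L) :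
    ∃ Q W, Confinement s x0 L Q W := by
  have hlip : ∀ W : Set P.Vec,
      (∀ i, ∀ j ∈ P.Nb i, LipschitzOnWith L (P.pgrad i j) (P.restr i '' W)) →
      ∀ i j, LipschitzOnWith L (P.pgrad i j) (P.restr i '' W) := fun W hW i j => by
    by_cases hj : j ∈ P.Nb i
    · exact hW i j hj
    · exact lipschitzOnWith_pgrad_of_notMem hj _ _
  rcases h with h | ⟨-, U, ψ, hψ, hlev, hresp, hL⟩
  · exact ⟨P.feas, P.feas,
      { level_subset := fun x hx => hx.1
        subset_feas := subset_rfl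
        subset := subset_rfl
        mix := fun w hw l => hw l l
        near := ⟨1, one_pos, fun _ _ y hy _ => hy⟩
        response := fun _ _ _ _ _ _ _ y hy _ => hy
        lipschitz := hlip _ fun i j hj => (h.2 i j hj).mono
          (Set.image_subset_iff.2 fun x hx => restr_mem_feasNb hx i) }⟩
  · exact ⟨P.cube U, P.wideCube U ψ,
      { level_subset := hlev
        subset_feas := fun x hx => hx.1
        subset := fun x hx => ⟨hx.1, x, hx, fun i => by simpa using hψ.le⟩
        mix := fun w hw => ⟨fun l => (hw l).1 l, fun l c => (hw l).2 l c⟩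
        near := ⟨ψ, hψ, fun x hx y hy h => ⟨hy, x, hx, h⟩⟩
        response := fun i w hw z hz x hx y hy h =>
          ⟨hy, x, hx, fun j => (h j).trans (hresp i w hw z hz)⟩
        lipschitz := hlip _ hL }⟩

end PartitionedProblem

/-! ### Estimates for one best-response step -/

namespace PartitionedProblem

section Step

variable {N : ℕ} {P : PartitionedProblem N} {s : P.Surrogates} {τ : ℝ} {Li : Fin N → ℝ≥0}
  {x0 : P.Vec} {L : ℝ≥0} {Q W : Set P.Vec}

lemma segment_subset_of_block_bound (hA : P.AssumptionA x0) {x y : P.Vec} {r : ℝ}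
    (hx : x ∈ P.feas) (hy : y ∈ P.feas) (hr : ∀ i, ‖y i - x i‖ ≤ r)
    (hW : ∀ u ∈ P.feas, (∀ i, ‖u i - x i‖ ≤ r) → u ∈ W) : segment ℝ x y ⊆ W := by
  intro u hu
  refine hW u (hA.convex_feas.segment_subset hx hy hu) fun i => ?_
  obtain ⟨t, ht, rfl⟩ := (segment_eq_image' ℝ x y ▸ hu :
    u ∈ (fun t : ℝ => x + t • (y - x)) '' Set.Icc 0 1)
  have e : (x + t • (y - x)) i - x i = t • (y i - x i) := by simp
  rw [e, norm_smul, Real.norm_of_nonneg ht.1]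
  exact (mul_le_of_le_one_left (norm_nonneg _) ht.2).trans (hr i)

lemma Confinement.norm_pgrad_sub_le (hQ : Confinement s x0 L Q W) {w v : P.Vec} (hw : w ∈ W)
    (hv : v ∈ W) {b : ℝ} (hb : 0 ≤ b) (h : ∀ l, ‖w l - v l‖ ≤ b) (j i : Fin N) :
    ‖P.pgrad j i (P.restr j w) - P.pgrad j i (P.restr j v)‖ ≤ L * (N * b) := by
  have h1 := (hQ.lipschitz j i).norm_sub_le (Set.mem_image_of_mem _ hw) (Set.mem_image_of_mem _ hv)
  exact h1.trans (mul_le_mul_of_nonneg_left (norm_restr_sub_restr_le hb h j) L.2)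

lemma Confinement.norm_sum_pgrad_sub_le (hQ : Confinement s x0 L Q W) {w v : Fin N → P.Vec}
    (hw : ∀ j, w j ∈ W) (hv : ∀ j, v j ∈ W) {b : ℝ} (hb : 0 ≤ b) (A : Finset (Fin N))
    (h : ∀ j ∈ A, ∀ l ∈ P.Nb j, ‖w j l - v j l‖ ≤ b) (i : Fin N) :
    ‖∑ j ∈ A, P.pgrad j i (P.restr j (w j)) - ∑ j ∈ A, P.pgrad j i (P.restr j (v j))‖ ≤
      N * (L * (N * b)) := by
  rw [← Finset.sum_sub_distrib]
  have hc : 0 ≤ (L : ℝ) * (N * b) := by positivity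
  refine (norm_sum_le _ _).trans
    ((Finset.sum_le_card_nsmul A _ (L * (N * b)) fun j hj => ?_).trans ?_)
  · have h1 := (hQ.lipschitz j i).norm_sub_le (Set.mem_image_of_mem _ (hw j))
      (Set.mem_image_of_mem _ (hv j))
    exact h1.trans (mul_le_mul_of_nonneg_left (norm_nbVec_le hb fun l => h j hj l.1 l.2) L.2)
  · rw [nsmul_eq_mul]
    refine mul_le_mul_of_nonneg_right ?_ hc
    exact_mod_cast (Finset.card_le_univ A).trans (by simp)

lemma Confinement.norm_gradF_apply_sub_le (hQ : Confinement s x0 L Q W) {x y : P.Vec} (hx : x ∈ W)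
    (hy : y ∈ W) {b : ℝ} (hb : 0 ≤ b) (h : ∀ l, ‖x l - y l‖ ≤ b) (i : Fin N) :
    ‖gradF x i - gradF y i‖ ≤ N * (L * (N * b)) := by
  rw [gradF_apply, gradF_apply]
  exact hQ.norm_sum_pgrad_sub_le (w := fun _ => x) (v := fun _ => y) (fun _ => hx) (fun _ => hy) hb
    Finset.univ (fun _ _ l _ => h l) i

lemma Confinement.norm_gradF_sub_le (hQ : Confinement s x0 L Q W) {x y : P.Vec} (hx : x ∈ W)
    (hy : y ∈ W) : ‖gradF x - gradF y‖ ≤ N ^ 3 * L * ‖x - y‖ := by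
  have h := norm_vec_le (P := P) (x := gradF x - gradF y) (b := N * (L * (N * ‖x - y‖)))
    (by positivity) fun i => hQ.norm_gradF_apply_sub_le hx hy (norm_nonneg _)
      (fun l => PiLp.norm_apply_le (x - y) l) i
  exact h.trans (le_of_eq (by ring))

lemma Confinement.abs_F_sub_le (hQ : Confinement s x0 L Q W) (hA : P.AssumptionA x0) {x y : P.Vec}
    (hseg : segment ℝ x y ⊆ W) :
    |P.F y - P.F x - inner ℝ (gradF x) (y - x)| ≤ N ^ 3 * L * ‖y - x‖ ^ 2 :=
  abs_sub_sub_inner_le_of_lipschitz_on_segment (by positivity)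
    (fun u hu => hA.smoothF.hasGradientAt (hQ.subset_feas (hseg hu)))
    fun u hu => hQ.norm_gradF_sub_le (hseg hu) (hseg (left_mem_segment ℝ x y))

/-- The gradient seen by a best response `z` differs from the true partial gradient at the current
point `x` by the length of the step and the age of the information. -/
lemma Confinement.norm_respGrad_sub_le (hQ : Confinement s x0 L Q W) (hC : AssumptionC s τ Li)
    {i : Fin N} {w : Fin N → P.Vec} (hw : ∀ j, w j ∈ W) {x : P.Vec} (hx : x ∈ W) {z : P.Blk i}
    (hz : z ∈ P.X i) (hxz : replaceBlock x i z ∈ W) {b : ℝ} (hb : 0 ≤ b)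
    (h : ∀ j ∈ P.Nb i, ∀ l ∈ P.Nb j, ‖w j l - x l‖ ≤ b) :
    ‖respGrad s i (fun j => P.restr j (w j)) z - gradF x i‖ ≤
      N * (Li i + L + N * L) * (b + ‖z - x i‖) := by
  set y := replaceBlock x i z with hy
  have hd := norm_nonneg (z - x i)
  have e1 : gradient (fun u => s i u (P.restr i y)) z = P.pgrad i i (P.restr i y) := by
    have := hC.grad_eq i _ (restr_mem_feasNb (hQ.subset_feas hxz) i)
    rwa [show P.restr i y ⟨i, P.self_mem i⟩ = z from replaceBlock_same x i z] at this
  have e2 : respGrad s i (fun j => P.restr j (w j)) z - gradF x i =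
      (gradient (fun u => s i u (P.restr i (w i))) z - gradient (fun u => s i u (P.restr i y)) z)
      + (P.pgrad i i (P.restr i y) - P.pgrad i i (P.restr i x))
      + (∑ j ∈ (P.Nb i).erase i, P.pgrad j i (P.restr j (w j))
        - ∑ j ∈ (P.Nb i).erase i, P.pgrad j i (P.restr j x)) := by
    rw [gradF_apply, sum_pgrad_eq i fun j => P.restr j x, respGrad, e1]
    abel
  have hyx := norm_replaceBlock_sub_apply_le x i z
  have b1 : ‖gradient (fun u => s i u (P.restr i (w i))) z -
      gradient (fun u => s i u (P.restr i y)) z‖ ≤ Li i * (N * (b + ‖z - x i‖)) := by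
    have h1 := (hC.grad_lipschitz i z hz).norm_sub_le
      (restr_mem_feasNb (hQ.subset_feas (hw i)) i) (restr_mem_feasNb (hQ.subset_feas hxz) i)
    refine h1.trans (mul_le_mul_of_nonneg_left ?_ (Li i).2)
    refine norm_nbVec_le (by positivity) fun l => ?_
    have e : (P.restr i (w i) - P.restr i y) l = (w i l.1 - x l.1) - (y l.1 - x l.1) := by
      simp [restr]
    rw [e]
    exact (norm_sub_le _ _).trans (add_le_add (h i (P.self_mem i) l.1 l.2) (hyx l.1))
  have b2 := hQ.norm_pgrad_sub_le hxz hx hd hyx i i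
  have b3 := hQ.norm_sum_pgrad_sub_le (v := fun _ => x) hw (fun _ => hx) hb ((P.Nb i).erase i)
    (fun j hj => h j (Finset.mem_of_mem_erase hj)) i
  rw [e2]
  refine (norm_add₃_le.trans (add_le_add (add_le_add b1 b2) b3)).trans ?_
  have n1 : 0 ≤ (L : ℝ) * (N * b) := by positivity
  have n2 : 0 ≤ (N : ℝ) * (L * (N * ‖z - x i‖)) := by positivity
  nlinarith

/-- A nontrivial step bounds the modulus of strong convexity by the Lipschitz constants, since the
surrogate gradient agrees with the true one at both ends of the step. -/
lemma Confinement.tau_le (hQ : Confinement s x0 L Q W) (hC : AssumptionC s τ Li)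
    {i : Fin N} {x : P.Vec} (hx : x ∈ W) {z : P.Blk i} (hz : z ∈ P.X i)
    (hxz : replaceBlock x i z ∈ W) (hne : z ≠ x i) : τ ≤ N * (Li i + L) := by
  set y := replaceBlock x i z with hy
  have hxf := hQ.subset_feas hx
  have hyf := hQ.subset_feas hxz
  have hd : 0 < ‖z - x i‖ := norm_pos_iff.2 (sub_ne_zero.2 hne)
  have e1 : gradient (fun u => s i u (P.restr i y)) z = P.pgrad i i (P.restr i y) := by
    have := hC.grad_eq i _ (restr_mem_feasNb hyf i)
    rwa [show P.restr i y ⟨i, P.self_mem i⟩ = z from replaceBlock_same x i z] at this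
  have e2 : gradient (fun u => s i u (P.restr i x)) (x i) = P.pgrad i i (P.restr i x) :=
    hC.grad_eq i _ (restr_mem_feasNb hxf i)
  have hyx := norm_replaceBlock_sub_apply_le x i z
  have h1 := (hC.grad_lipschitz i z hz).norm_sub_le
      (restr_mem_feasNb hxf i) (restr_mem_feasNb hyf i)
  have h2 := hQ.norm_pgrad_sub_le hxz hx hd.le hyx i i
  have h3 : ‖P.restr i x - P.restr i y‖ ≤ N * ‖z - x i‖ := by
    rw [norm_sub_rev]
    exact norm_restr_sub_restr_le hd.le hyx i
  have h4 := (hC.strong_convex i _ (restr_mem_feasNb hxf i)).mul_norm_sq_le_inner hz (hxf i)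
    (hC.hasGradientAt (restr_mem_feasNb hxf i) hz) (hC.hasGradientAt (restr_mem_feasNb hxf i) (hxf i))
  have h5 : ‖gradient (fun u => s i u (P.restr i x)) z -
      gradient (fun u => s i u (P.restr i x)) (x i)‖ ≤ N * (Li i + L) * ‖z - x i‖ := by
    have e : gradient (fun u => s i u (P.restr i x)) z -
        gradient (fun u => s i u (P.restr i x)) (x i) =
        (gradient (fun u => s i u (P.restr i x)) z - gradient (fun u => s i u (P.restr i y)) z)
        + (P.pgrad i i (P.restr i y) - P.pgrad i i (P.restr i x)) := by
      rw [e1, e2]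
      abel
    rw [e]
    refine (norm_add_le _ _).trans
      ((add_le_add (h1.trans (mul_le_mul_of_nonneg_left h3 (Li i).2)) h2).trans (le_of_eq ?_))
    ring
  have h6 := h4.trans ((real_inner_le_norm _ _).trans (mul_le_mul_of_nonneg_right h5 hd.le))
  have h7 : τ * ‖z - x i‖ ^ 2 ≤ N * (Li i + L) * ‖z - x i‖ ^ 2 := by linarith [sq ‖z - x i‖]
  exact le_of_mul_le_mul_right h7 (by positivity)

/-- The change of the objective in one damped block step. -/
lemma Confinement.V_step_le (hQ : Confinement s x0 L Q W) (hA : P.AssumptionA x0) {i : Fin N}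
    {x : P.Vec} (hx : x ∈ Q) {z : P.Blk i} (hz : z ∈ P.X i) {γ : ℝ} (hγ : 0 ≤ γ) (hγ1 : γ ≤ 1)
    (hW : ∀ u ∈ P.feas, (∀ j, ‖u j - x j‖ ≤ ‖z - x i‖) → u ∈ W) :
    P.V (replaceBlock x i (x i + γ • (z - x i))) - P.V x ≤
      γ * (inner ℝ (gradF x i) (z - x i) + P.g i z - P.g i (x i))
        + N ^ 3 * L * (γ * ‖z - x i‖) ^ 2 := by
  set u := x i + γ • (z - x i) with hu
  set y := replaceBlock x i u with hy
  have hxf : x ∈ P.feas := hQ.subset_feas (hQ.subset hx)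
  have hu' : u = (1 - γ) • x i + γ • z := by rw [hu]; module
  have huX : u ∈ P.X i := by
    rw [hu']
    exact hA.convex i (hxf i) hz (by linarith) hγ (by ring)
  have hyf : y ∈ P.feas := replaceBlock_mem_feas hxf huX
  have hux : ‖u - x i‖ = γ * ‖z - x i‖ := by
    rw [hu, add_sub_cancel_left, norm_smul, Real.norm_of_nonneg hγ]
  have hseg : segment ℝ x y ⊆ W := by
    refine segment_subset_of_block_bound hA hxf hyf (fun l => ?_) hW
    refine (norm_replaceBlock_sub_apply_le x i u l).trans ?_
    rw [hux]
    exact mul_le_of_le_one_left (norm_nonneg _) hγ1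
  have hF := (le_abs_self _).trans (hQ.abs_F_sub_le hA hseg)
  have hin : inner ℝ (gradF x) (y - x) = γ * inner ℝ (gradF x i) (z - x i) := by
    rw [inner_replaceBlock_sub, hu, add_sub_cancel_left, inner_smul_right]
  have hnorm : ‖y - x‖ ≤ γ * ‖z - x i‖ := hux ▸ norm_replaceBlock_sub_le x i u
  have hG : P.G y - P.G x = P.g i u - P.g i (x i) := by
    rw [G, G, ← Finset.sum_sub_distrib, Finset.sum_eq_single i]
    · simp [hy]
    · intro l _ hl
      simp [hy, replaceBlock_of_ne _ _ hl]
    · simp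
  have hg : P.g i u ≤ (1 - γ) * P.g i (x i) + γ * P.g i z := by
    rw [hu']
    exact (hA.g_convex i).2 (hxf i) hz (by linarith) hγ (by ring)
  have hsq : N ^ 3 * L * ‖y - x‖ ^ 2 ≤ N ^ 3 * L * (γ * ‖z - x i‖) ^ 2 :=
    mul_le_mul_of_nonneg_left (pow_le_pow_left₀ (norm_nonneg _) hnorm 2) (by positivity)
  rw [hin] at hF
  rw [V, V]
  linarith

end Step

end PartitionedProblem

/-! ### Descent along a run -/

namespace PartitionedProblem

section Run

variable {N : ℕ} {P : PartitionedProblem N} {s : P.Surrogates} {τ γ : ℝ} {Li : Fin N → ℝ≥0}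
  {x0 : P.Vec} {L : ℝ≥0} {Q W : Set P.Vec} {B D : ℕ} {a : ℕ → Fin N}
  {d : ℕ → Fin N → Fin N → Fin N → ℕ} {x : ℕ → P.Vec} {z : ∀ k, P.Blk (a k)}

/-- The feasible vector whose restriction to `N_j` is the delayed information on `f j`. -/
def infoVec (x : ℕ → P.Vec) (k : ℕ) (d : Fin N → ℕ) : P.Vec :=
  WithLp.toLp 2 fun l => x (k - d l) l

@[simp] lemma infoVec_apply (x : ℕ → P.Vec) (k : ℕ) (d : Fin N → ℕ) (l : Fin N) :
    infoVec x k d l = x (k - d l) l := rfl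

/-- `z` are the best responses that produce the run `x`. -/
structure IsResponseSeq (s : P.Surrogates) (γ : ℝ) (a : ℕ → Fin N)
    (d : ℕ → Fin N → Fin N → Fin N → ℕ) (x : ℕ → P.Vec) (z : ∀ k, P.Blk (a k)) : Prop where
  own_delay : ∀ k i, d k i i i = 0
  isBestResponse : ∀ k, IsBestResponse s (a k)
    (fun j => P.restr j (infoVec x k (d k (a k) j))) (x k (a k)) (z k)
  next : ∀ k, x (k + 1) = replaceBlock (x k) (a k) (x k (a k) + γ • (z k - x k (a k)))

lemma IsRun.exists_isResponseSeq (h : IsRun s γ a d x) :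
    ∃ z : ∀ k, P.Blk (a k), IsResponseSeq s γ a d x z := by
  choose z hz hnext using h.update
  refine ⟨z, h.own_delay, hz, fun k => ?_⟩
  ext1 l
  by_cases hl : l = a k
  · subst hl
    rw [replaceBlock_same, hnext]
  · rw [replaceBlock_of_ne _ _ hl, h.keep k l hl]

/-- The length `‖z k - x k‖` of the best-response step at time `k`, shifted in time by `D`: it is the
value at `k + D`, and the values before `D` are zero. So the steps of the `D` iterations before
time `k` are the values on `[k, k + D)`, also for small `k`. -/
def stepLen (D : ℕ) (x : ℕ → P.Vec) (z : ∀ k, P.Blk (a k)) (m : ℕ) : ℝ :=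
  if m < D then 0 else ‖z (m - D) - x (m - D) (a (m - D))‖

lemma stepLen_of_lt {m : ℕ} (h : m < D) : stepLen D x z m = 0 := by simp [stepLen, h]

lemma stepLen_add (k : ℕ) : stepLen D x z (k + D) = ‖z k - x k (a k)‖ := by
  have e : ∀ m, m = k → ‖z m - x m (a m)‖ = ‖z k - x k (a k)‖ := by
    rintro _ rfl
    rfl
  rw [stepLen, if_neg (by omega), e _ (Nat.add_sub_cancel k D)]

lemma stepLen_nonneg (m : ℕ) : 0 ≤ stepLen D x z m := by
  rw [stepLen]
  split_ifs
  · exact le_rfl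
  · exact norm_nonneg _

lemma sum_stepLen_nonneg (k T : ℕ) : 0 ≤ ∑ j ∈ Finset.range T, stepLen D x z (k + j) :=
  Finset.sum_nonneg fun _ _ => stepLen_nonneg _

lemma sum_stepLen_mono {k T k' T' : ℕ} (h1 : k ≤ k') (h2 : k' + T' ≤ k + T) :
    ∑ j ∈ Finset.range T', stepLen D x z (k' + j) ≤
      ∑ j ∈ Finset.range T, stepLen D x z (k + j) := by
  have e : ∀ m n, ∑ j ∈ Finset.range n, stepLen D x z (m + j) =
      ∑ l ∈ Finset.Ico m (m + n), stepLen D x z l := fun m n => by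
    rw [Finset.sum_Ico_eq_sum_range, Nat.add_sub_cancel_left]
  rw [e, e]
  exact Finset.sum_le_sum_of_subset_of_nonneg (Finset.Ico_subset_Ico h1 h2)
    fun _ _ _ => stepLen_nonneg _

lemma sq_sum_stepLen_le (k T : ℕ) : (∑ j ∈ Finset.range T, stepLen D x z (k + j)) ^ 2 ≤
    T * ∑ j ∈ Finset.range T, stepLen D x z (k + j) ^ 2 := by
  simpa using sq_sum_le_card_mul_sum_sq (s := Finset.range T)
    (f := fun j => stepLen D x z (k + j))

lemma stepLen_le_sum {k T m : ℕ} (h1 : k ≤ m) (h2 : m < k + T) :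
    stepLen D x z m ≤ ∑ j ∈ Finset.range T, stepLen D x z (k + j) := by
  have := sum_stepLen_mono (D := D) (x := x) (z := z) (k := k) (T := T) (k' := m) (T' := 1) h1
    (by omega)
  simpa using this

lemma IsResponseSeq.dist_succ_le (h : IsResponseSeq s γ a d x z) (hγ : 0 ≤ γ) (m : ℕ) :
    dist (x (m - D)) (x (m + 1 - D)) ≤ γ * stepLen D x z m := by
  rcases lt_or_ge m D with hm | hm
  · rw [show m - D = 0 by omega, show m + 1 - D = 0 by omega, dist_self]
    exact mul_nonneg hγ (stepLen_nonneg m)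
  · obtain ⟨k, rfl⟩ : ∃ k, m = k + D := ⟨m - D, by omega⟩
    rw [show k + D - D = k by omega, show k + D + 1 - D = k + 1 by omega, stepLen_add, dist_comm,
      dist_eq_norm, h.next]
    refine (norm_replaceBlock_sub_le _ _ _).trans (le_of_eq ?_)
    rw [add_sub_cancel_left, norm_smul, Real.norm_of_nonneg hγ]

/-- Two iterates whose shifted times lie in a window differ by at most the length of the
steps in it. -/
lemma IsResponseSeq.norm_iterate_sub_le (h : IsResponseSeq s γ a d x z) (hγ : 0 ≤ γ) {k T m n : ℕ}
    (hm : k ≤ m) (hm' : m ≤ k + T) (hn : k ≤ n) (hn' : n ≤ k + T) :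
    ‖x (m - D) - x (n - D)‖ ≤ γ * ∑ j ∈ Finset.range T, stepLen D x z (k + j) := by
  wlog hmn : m ≤ n generalizing m n
  · rw [norm_sub_rev]
    exact this hn hn' hm hm' (by omega)
  rw [← dist_eq_norm]
  refine (dist_le_Ico_sum_of_dist_le (f := fun m => x (m - D)) hmn
    fun {l} _ _ => h.dist_succ_le hγ l).trans ?_
  rw [← Finset.mul_sum, Finset.sum_Ico_eq_sum_range]
  exact mul_le_mul_of_nonneg_left (sum_stepLen_mono hm (by omega)) hγ

lemma IsResponseSeq.norm_infoVec_sub_le (h : IsResponseSeq s γ a d x z) (hγ : 0 ≤ γ)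
    (hD : AssumptionD P B D a d) {k T t r : ℕ} (ht : k ≤ t) (ht' : t + D ≤ k + T)
    (hr : k ≤ r + D) (hr' : r + D ≤ k + T) {i j l : Fin N} (hj : j ∈ P.Nb i) (hl : l ∈ P.Nb j) :
    ‖infoVec x t (d t i j) l - x r l‖ ≤ γ * ∑ j ∈ Finset.range T, stepLen D x z (k + j) := by
  have hdel := hD.delay_le t i j hj l hl
  have h1 := h.norm_iterate_sub_le hγ (D := D) (m := t + D - d t i j l) (n := r + D) (k := k) (T := T)
    (by omega) (by omega) hr hr'
  rw [show t + D - d t i j l - D = t - d t i j l by omega, show r + D - D = r by omega] at h1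
  exact (PiLp.norm_apply_le (x (t - d t i j l) - x r) l).trans h1

lemma Confinement.infoVec_mem (hQ : Confinement s x0 L Q W) {k : ℕ} (hx : ∀ m ≤ k, x m ∈ Q)
    (e : Fin N → ℕ) : infoVec x k e ∈ Q :=
  hQ.mix (fun l => x (k - e l)) fun _ => hx _ (Nat.sub_le _ _)

/-- A feasible point within the length of the step at time `k` from a point of `Q` lies in `W`. -/
lemma IsResponseSeq.mem_of_norm_le (h : IsResponseSeq s γ a d x z) (hQ : Confinement s x0 L Q W)
    {k : ℕ} (hx : ∀ m ≤ k, x m ∈ Q) {y u : P.Vec} (hy : y ∈ Q) (hu : u ∈ P.feas)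
    (huy : ∀ j, ‖u j - y j‖ ≤ ‖z k - x k (a k)‖) : u ∈ W := by
  have e : infoVec x k (d k (a k) (a k)) (a k) = x k (a k) := by
    rw [infoVec_apply, h.own_delay, Nat.sub_zero]
  have hz := h.isBestResponse k
  refine hQ.response (a k) (fun j => infoVec x k (d k (a k) j))
    (fun j => hQ.infoVec_mem hx _) (z k) ?_ y hy u hu ?_
  · rw [e]
    exact hz
  · rw [e]
    exact huy

/-- The coefficient of the squared delayed steps in the descent inequality. -/
def delayConst (N D : ℕ) (L : ℝ≥0) : ℝ := (N ^ 2 * L + N ^ 3 * L) * (D + 1)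

lemma delayConst_nonneg (N D : ℕ) (L : ℝ≥0) : 0 ≤ delayConst N D L := by
  unfold delayConst
  positivity

/-- The descent inequality: strong convexity gains `γ τ` times the squared step, and the outdated
information costs terms of order `γ ^ 2`. -/
lemma IsResponseSeq.V_succ_le (h : IsResponseSeq s γ a d x z) (hA : P.AssumptionA x0)
    (hC : AssumptionC s τ Li) (hQ : Confinement s x0 L Q W) (hD : AssumptionD P B D a d)
    (hγ : 0 ≤ γ) (hγ1 : γ ≤ 1) {k : ℕ} (hx : ∀ m ≤ k, x m ∈ Q) :
    P.V (x (k + 1)) ≤ P.V (x k) - γ * τ * stepLen D x z (k + D) ^ 2 +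
      γ ^ 2 * delayConst N D L * ∑ j ∈ Finset.range (D + 1), stepLen D x z (k + j) ^ 2 := by
  set i := a k with hi
  set w : Fin N → P.Vec := fun j => infoVec x k (d k i j) with hw
  have hwQ : ∀ j, w j ∈ Q := fun j => hQ.infoVec_mem hx _
  have hxQ := hx k le_rfl
  have hxf := hQ.subset_feas (hQ.subset hxQ)
  have hwf : P.restr i (w i) ∈ P.feasNb i :=
    restr_mem_feasNb (hQ.subset_feas (hQ.subset (hwQ i))) i
  have hz := h.isBestResponse k
  have hstep := hQ.V_step_le hA hxQ hz.1 hγ hγ1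
    fun u hu huk => h.mem_of_norm_le hQ hx hxQ hu huk
  rw [← h.next k] at hstep
  have hopt := hz.g_sub_le hA hC hwf (hxf i)
  -- the agent knows its own block, so the surrogate gradient there is the partial gradient
  have hgrad : respGrad s i (fun j => P.restr j (w j)) (x k i) =
      ∑ j ∈ P.Nb i, P.pgrad j i (P.restr j (w j)) := by
    have e := hC.grad_eq i _ hwf
    have e' : P.restr i (w i) ⟨i, P.self_mem i⟩ = x k i := by
      change x (k - d k i i i) i = x k i
      rw [h.own_delay, Nat.sub_zero]
    rw [e'] at e
    rw [respGrad, e, Finset.add_sum_erase _ (fun j => P.pgrad j i (P.restr j (w j))) (P.self_mem i)]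
  rw [hgrad] at hopt
  set S := ∑ j ∈ Finset.range (D + 1), stepLen D x z (k + j) with hS
  have hS0 : 0 ≤ S := sum_stepLen_nonneg _ _
  set δ := ‖z k - x k i‖ with hδ
  have hδ0 : 0 ≤ δ := norm_nonneg _
  have hδS : δ ≤ S := by
    rw [hδ, ← stepLen_add (D := D)]
    exact stepLen_le_sum (by omega) (by omega)
  have herr : ‖gradF (x k) i - ∑ j ∈ P.Nb i, P.pgrad j i (P.restr j (w j))‖ ≤
      N * (L * (N * (γ * S))) := by
    rw [gradF_apply_eq_sum_Nb, norm_sub_rev]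
    refine hQ.norm_sum_pgrad_sub_le (v := fun _ => x k) (fun j => hQ.subset (hwQ j))
      (fun _ => hQ.subset hxQ) (by positivity) (P.Nb i) (fun j hj l hl => ?_) i
    exact h.norm_infoVec_sub_le hγ hD (T := D + 1) le_rfl (by omega) (by omega) (by omega) hj hl
  have hin := (real_inner_le_norm (gradF (x k) i - ∑ j ∈ P.Nb i, P.pgrad j i (P.restr j (w j)))
    (z k - x k i)).trans (mul_le_mul herr hδS hδ0 (by positivity))
  rw [inner_sub_left] at hin
  have hsq : S ^ 2 ≤ (D + 1) * ∑ j ∈ Finset.range (D + 1), stepLen D x z (k + j) ^ 2 := by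
    simpa using sq_sum_stepLen_le (D := D) (x := x) (z := z) k (D + 1)
  have hδ2 : δ ^ 2 ≤ S ^ 2 := pow_le_pow_left₀ hδ0 hδS 2
  have e1 : γ * (inner ℝ (gradF (x k) i) (z k - x k i) + P.g i (z k) - P.g i (x k i)) ≤
      γ * (-(τ * δ ^ 2) + N * (L * (N * (γ * S))) * S) :=
    mul_le_mul_of_nonneg_left (by linarith) hγ
  have e2 : (N : ℝ) ^ 3 * L * (γ * δ) ^ 2 ≤ N ^ 3 * L * γ ^ 2 * S ^ 2 := by
    rw [mul_pow, ← mul_assoc]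
    exact mul_le_mul_of_nonneg_left hδ2 (by positivity)
  have e3 : γ ^ 2 * (N ^ 2 * L + N ^ 3 * L) * S ^ 2 ≤ γ ^ 2 * delayConst N D L *
      ∑ j ∈ Finset.range (D + 1), stepLen D x z (k + j) ^ 2 := by
    refine (mul_le_mul_of_nonneg_left hsq (by positivity)).trans (le_of_eq ?_)
    rw [delayConst]
    ring
  rw [stepLen_add]
  linarith

/-- For small steps the iterates never leave the level set of the initial point: the energy
decreases, and it starts at the initial value because there are no steps before time zero. -/
lemma IsResponseSeq.mem_level (h : IsResponseSeq s γ a d x z) (hA : P.AssumptionA x0)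
    (hC : AssumptionC s τ Li) (hQ : Confinement s x0 L Q W) (hD : AssumptionD P B D a d)
    (hx0 : x 0 = x0) (hf : x0 ∈ P.feas) (hγ : 0 ≤ γ) (hγ1 : γ ≤ 1)
    (hsmall : γ ^ 2 * delayConst N D L * (D + 1) ≤ γ * τ / 2) (k : ℕ) : x k ∈ P.level x0 := by
  set q : ℕ → ℝ := fun m => stepLen D x z m ^ 2 with hq
  have hq0 : ∀ m, 0 ≤ q m := fun m => sq_nonneg _
  have hb : 0 ≤ γ ^ 2 * delayConst N D L := mul_nonneg (sq_nonneg γ) (delayConst_nonneg N D L)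
  have key : ∀ k, (∀ m ≤ k, x m ∈ P.level x0) ∧
      P.V (x k) + γ ^ 2 * delayConst N D L * delayEnergy D q k ≤ P.V x0 := by
    intro k
    induction k with
    | zero =>
      refine ⟨fun m hm => ?_, ?_⟩
      · obtain rfl : m = 0 := by omega
        rw [hx0]
        exact ⟨hf, le_rfl⟩
      · have : delayEnergy D q 0 = 0 := Finset.sum_eq_zero fun j hj => by
          rw [hq]
          simp only [zero_add]
          rw [stepLen_of_lt (Finset.mem_range.1 hj)]
          simp
        rw [this, hx0]
        simp
    | succ k ih =>
      have hxQ : ∀ m ≤ k, x m ∈ Q := fun m hm => hQ.level_subset (ih.1 m hm)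
      have hs := energy_succ_le (v := fun k => P.V (x k)) hq0 hsmall
        (h.V_succ_le hA hC hQ hD hγ hγ1 hxQ)
      have hp : 0 ≤ γ * τ / 2 * q (k + D) :=
        mul_nonneg (div_nonneg (mul_nonneg hγ hC.tau_pos.le) zero_le_two) (hq0 _)
      have hV : P.V (x (k + 1)) + γ ^ 2 * delayConst N D L * delayEnergy D q (k + 1) ≤ P.V x0 := by
        linarith [ih.2]
      refine ⟨fun m hm => ?_, hV⟩
      rcases Nat.lt_or_ge m (k + 1) with hlt | hge
      · exact ih.1 m (by omega)
      · obtain rfl : m = k + 1 := by omega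
        refine ⟨?_, ?_⟩
        · have hxf := (ih.1 k le_rfl).1
          rw [h.next]
          refine replaceBlock_mem_feas hxf ?_
          rw [show x k (a k) + γ • (z k - x k (a k)) = (1 - γ) • x k (a k) + γ • z k by module]
          exact hA.convex _ (hxf _) (h.isBestResponse k).1 (by linarith) hγ (by ring)
        · linarith [mul_nonneg hb (delayEnergy_nonneg (D := D) hq0 (k + 1))]
  exact (key k).1 k le_rfl

/-- The squared steps are summable, since the objective is bounded below. -/
lemma IsResponseSeq.tendsto_stepLen (h : IsResponseSeq s γ a d x z) (hA : P.AssumptionA x0)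
    (hC : AssumptionC s τ Li) (hQ : Confinement s x0 L Q W) (hD : AssumptionD P B D a d)
    (hx : ∀ k, x k ∈ P.level x0) (hγ : 0 < γ) (hγ1 : γ ≤ 1)
    (hsmall : γ ^ 2 * delayConst N D L * (D + 1) ≤ γ * τ / 2) :
    Tendsto (stepLen D x z) atTop (𝓝 0) := by
  set q : ℕ → ℝ := fun m => stepLen D x z m ^ 2 with hq
  have hq0 : ∀ m, 0 ≤ q m := fun m => sq_nonneg _
  have hb : 0 ≤ γ ^ 2 * delayConst N D L := mul_nonneg (sq_nonneg γ) (delayConst_nonneg N D L)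
  have hp : 0 < γ * τ / 2 := half_pos (mul_pos hγ hC.tau_pos)
  obtain ⟨y, hy, hmin⟩ := hA.solvable
  have hsum : Summable fun j => q (D + j) := by
    refine summable_of_sum_range_le (c := (P.V (x 0) + γ ^ 2 * delayConst N D L *
      delayEnergy D q 0 - P.V y) / (γ * τ / 2)) (fun j => hq0 _) fun n => ?_
    have := energy_add_sum_le (v := fun k => P.V (x k)) hq0 hsmall
      (fun k => h.V_succ_le hA hC hQ hD hγ.le hγ1 fun m _ => hQ.level_subset (hx m)) 0 n
    simp only [zero_add] at this
    rw [le_div_iff₀ hp]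
    have h1 := hmin (x n) (hx n).1
    have h2 := mul_nonneg hb (delayEnergy_nonneg (D := D) hq0 n)
    linarith
  have h1 : Tendsto q atTop (𝓝 0) := by
    rw [← tendsto_add_atTop_iff_nat D]
    simpa only [add_comm] using hsum.tendsto_atTop_zero
  have h2 : Tendsto (fun m => Real.sqrt (q m)) atTop (𝓝 0) := by
    have := (Real.continuous_sqrt.tendsto 0).comp h1
    rwa [Real.sqrt_zero] at this
  refine h2.congr fun m => ?_
  rw [hq]
  exact Real.sqrt_sq (stepLen_nonneg m)

end Run

end PartitionedProblem

/-! ### Estimates over a window in which every agent is active -/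

namespace PartitionedProblem

section Window

variable {N : ℕ} {P : PartitionedProblem N} {s : P.Surrogates} {τ γ : ℝ} {Li : Fin N → ℝ≥0}
  {x0 : P.Vec} {L : ℝ≥0} {Q W : Set P.Vec} {B D : ℕ} {a : ℕ → Fin N}
  {d : ℕ → Fin N → Fin N → Fin N → ℕ} {x : ℕ → P.Vec} {z : ∀ k, P.Blk (a k)}

/-- Total length of the steps taken in the `B` iterations from time `k` on and in the `D`
iterations before. -/
def windowLen (B D : ℕ) (x : ℕ → P.Vec) (z : ∀ k, P.Blk (a k)) (k : ℕ) : ℝ :=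
  ∑ j ∈ Finset.range (D + B), stepLen D x z (k + j)

lemma windowLen_nonneg (k : ℕ) : 0 ≤ windowLen B D x z k := sum_stepLen_nonneg _ _

/-- Bound for the errors of the gradients that the agents use, relative to the step lengths in
a window. -/
def gradErrConst (N : ℕ) (L Lm : ℝ≥0) : ℝ := 2 * N * (Lm + L + N * L)

/-- Bound for the prox residual relative to the step lengths in a window. -/
def residualConst (N : ℕ) (L Lm : ℝ≥0) : ℝ := N * gradErrConst N L Lm + 2 * N

lemma gradErrConst_nonneg (N : ℕ) (L Lm : ℝ≥0) : 0 ≤ gradErrConst N L Lm := by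
  unfold gradErrConst
  positivity

lemma residualConst_nonneg (N : ℕ) (L Lm : ℝ≥0) : 0 ≤ residualConst N L Lm := by
  have := gradErrConst_nonneg N L Lm
  unfold residualConst
  positivity

/-- In the window from time `k` on, agent `i` first acts at time `t`, with best response `zi`, and its
block is then still the one at time `k`. The gradient that it uses and the gain of its step are
compared with the point at time `k`. -/
structure IsFirstResponse (s : P.Surrogates) (γ : ℝ) (L Lm : ℝ≥0) (B D : ℕ) (a : ℕ → Fin N)
    (x : ℕ → P.Vec) (z : ∀ k, P.Blk (a k)) (k : ℕ) (i : Fin N) (t : ℕ) (zi ξ : P.Blk i) :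
    Prop where
  le : k ≤ t
  lt : t < k + B
  agent : a t = i
  mem : zi ∈ P.X i
  norm_sub : ‖zi - x k i‖ ≤ windowLen B D x z k
  optimal : ∀ u ∈ P.X i, 0 ≤ inner ℝ ξ (u - zi) + P.g i u - P.g i zi
  grad_err : ‖ξ - gradF (x k) i‖ ≤ gradErrConst N L Lm * windowLen B D x z k
  gain : P.V (x (t + 1)) - P.V (x t) ≤
    γ * (inner ℝ (gradF (x k) i) (zi - x k i) + P.g i zi - P.g i (x k i))
      + γ * (2 * N ^ 3 * L) * windowLen B D x z k ^ 2

lemma AssumptionD.exists_first (hD : AssumptionD P B D a d) (k : ℕ) (i : Fin N) :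
    ∃ t, k ≤ t ∧ t < k + B ∧ a t = i ∧ ∀ m, k ≤ m → m < t → a m ≠ i := by
  classical
  have hex : ∃ t, k ≤ t ∧ a t = i := by
    obtain ⟨t, h1, -, h2⟩ := hD.active k i
    exact ⟨t, h1, h2⟩
  obtain ⟨t', h1, h2, h3⟩ := hD.active k i
  refine ⟨Nat.find hex, (Nat.find_spec hex).1, (Nat.find_min' hex ⟨h1, h3⟩).trans_lt h2,
    (Nat.find_spec hex).2, fun m hm hlt h => Nat.find_min hex hlt ⟨hm, h⟩⟩

lemma IsResponseSeq.block_eq (h : IsResponseSeq s γ a d x z) {k t : ℕ} {i : Fin N} (hkt : k ≤ t)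
    (hne : ∀ m, k ≤ m → m < t → a m ≠ i) : x t i = x k i := by
  induction t, hkt using Nat.le_induction with
  | base => rfl
  | succ t hkt ih =>
    rw [h.next, replaceBlock_of_ne _ _ (hne t hkt (Nat.lt_succ_self t)).symm]
    exact ih fun m hm hlt => hne m hm (by omega)

lemma IsResponseSeq.exists_isFirstResponse (h : IsResponseSeq s γ a d x z) (hA : P.AssumptionA x0)
    (hC : AssumptionC s τ Li) (hQ : Confinement s x0 L Q W) (hD : AssumptionD P B D a d)
    (hγ : 0 ≤ γ) (hγ1 : γ ≤ 1) (hx : ∀ k, x k ∈ Q) (k : ℕ) (i : Fin N) :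
    ∃ t zi ξ, IsFirstResponse s γ L (Finset.univ.sup Li) B D a x z k i t zi ξ := by
  obtain ⟨t, hkt, htB, rfl, hne⟩ := hD.exists_first k i
  have hblk := h.block_eq hkt hne
  set i := a t with hi
  set w : Fin N → P.Vec := fun j => infoVec x t (d t i j) with hw
  set σ := windowLen B D x z k with hσ
  have hσ0 : 0 ≤ σ := windowLen_nonneg k
  have hwQ : ∀ j, w j ∈ Q := fun j => hQ.infoVec_mem (fun m _ => hx m) _
  have hz := h.isBestResponse t
  have hwf : P.restr i (w i) ∈ P.feasNb i :=
    restr_mem_feasNb (hQ.subset_feas (hQ.subset (hwQ i))) i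
  have hδ : ‖z t - x k i‖ ≤ σ := by
    rw [← hblk, ← stepLen_add (D := D)]
    exact stepLen_le_sum (by omega) (by omega)
  have hγσ : γ * σ ≤ σ := mul_le_of_le_one_left hσ0 hγ1
  have hmem : replaceBlock (x k) i (z t) ∈ W := by
    refine h.mem_of_norm_le hQ (k := t) (fun m _ => hx m) (hx k)
      (replaceBlock_mem_feas (hQ.subset_feas (hQ.subset (hx k))) hz.1) fun j => ?_
    rw [hblk]
    exact norm_replaceBlock_sub_apply_le _ _ _ j
  refine ⟨t, z t, respGrad s i (fun j => P.restr j (w j)) (z t), hkt, htB, rfl, hz.1, hδ,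
    fun u hu => hz.variational_inequality hA hC hwf hu, ?_, ?_⟩
  · refine (hQ.norm_respGrad_sub_le hC (fun j => hQ.subset (hwQ j)) (hQ.subset (hx k)) hz.1 hmem
      (b := γ * σ) (by positivity) fun j hj l hl => ?_).trans ?_
    · exact h.norm_infoVec_sub_le hγ hD hkt (by omega) (by omega) (by omega) hj hl
    · have hLi : (Li i : ℝ) ≤ ((Finset.univ.sup Li : ℝ≥0) : ℝ) := by
        exact_mod_cast Finset.le_sup (f := Li) (Finset.mem_univ i)
      calc N * (Li i + L + N * L) * (γ * σ + ‖z t - x k i‖)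
          ≤ N * (((Finset.univ.sup Li : ℝ≥0) : ℝ) + L + N * L) * (σ + σ) := by
            gcongr
        _ = _ := by rw [gradErrConst]; ring
  · have hstep := hQ.V_step_le hA (hx t) hz.1 hγ hγ1
      fun u hu huk => h.mem_of_norm_le hQ (fun m _ => hx m) (hx t) hu huk
    rw [← h.next t, hblk] at hstep
    have hdist : ‖x t - x k‖ ≤ γ * σ := by
      have := h.norm_iterate_sub_le hγ (D := D) (k := k) (T := D + B) (m := t + D) (n := k + D)
        (by omega) (by omega) (by omega) (by omega)
      rwa [Nat.add_sub_cancel, Nat.add_sub_cancel] at this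
    have hg : ‖gradF (x t) i - gradF (x k) i‖ ≤ N ^ 3 * L * σ := by
      refine (PiLp.norm_apply_le (gradF (x t) - gradF (x k)) i).trans ?_
      refine (hQ.norm_gradF_sub_le (hQ.subset (hx t)) (hQ.subset (hx k))).trans ?_
      exact mul_le_mul_of_nonneg_left (hdist.trans hγσ) (by positivity)
    have hin := (real_inner_le_norm (gradF (x t) i - gradF (x k) i) (z t - x k i)).trans
      (mul_le_mul hg hδ (norm_nonneg _) (by positivity))
    rw [inner_sub_left] at hin
    have hin' := mul_le_mul_of_nonneg_left hin hγ
    have hsq : (N : ℝ) ^ 3 * L * (γ * ‖z t - x k i‖) ^ 2 ≤ γ * (N ^ 3 * L) * σ ^ 2 := by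
      have e1 : ‖z t - x k i‖ ^ 2 ≤ σ ^ 2 := pow_le_pow_left₀ (norm_nonneg _) hδ 2
      have e2 : γ ^ 2 ≤ γ := by nlinarith
      calc (N : ℝ) ^ 3 * L * (γ * ‖z t - x k i‖) ^ 2
          = N ^ 3 * L * (γ ^ 2 * ‖z t - x k i‖ ^ 2) := by ring
        _ ≤ N ^ 3 * L * (γ * σ ^ 2) := by gcongr
        _ = _ := by ring
    linarith

/-- The prox residual at time `k` is bounded by the steps in the window: the optimality conditions of
the first responses and of the proximal point are tested against each other. -/
lemma norm_sub_prox_le (hA : P.AssumptionA x0) {Lm : ℝ≥0} {k : ℕ} {t : Fin N → ℕ}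
    {zi ξ : ∀ i, P.Blk i}
    (hfirst : ∀ i, IsFirstResponse s γ L Lm B D a x z k i (t i) (zi i) (ξ i)) {p : P.Vec}
    (hp : P.IsProx (x k - gradF (x k)) p) :
    ‖x k - p‖ ≤ residualConst N L Lm * windowLen B D x z k := by
  set σ := windowLen B D x z k with hσ
  have hσ0 : 0 ≤ σ := windowLen_nonneg k
  have hc := gradErrConst_nonneg N L Lm
  set y : P.Vec := WithLp.toLp 2 zi with hy
  set ζ : P.Vec := WithLp.toLp 2 ξ with hζ
  have hyf : y ∈ P.feas := fun i => (hfirst i).mem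
  have h1 : ‖ζ - gradF (x k)‖ ≤ N * (gradErrConst N L Lm * σ) :=
    norm_vec_le (by positivity) fun i => (hfirst i).grad_err
  have h2 : ‖y - x k‖ ≤ N * σ := norm_vec_le hσ0 fun i => (hfirst i).norm_sub
  have h3 : 0 ≤ inner ℝ ζ (p - y) + P.G p - P.G y := by
    rw [PiLp.inner_apply, G, G, ← Finset.sum_add_distrib, ← Finset.sum_sub_distrib]
    exact Finset.sum_nonneg fun i _ => (hfirst i).optimal (p i) (hp.1 i)
  have h4 := hp.variational_inequality hA hyf
  have h5 : ‖p - y‖ ^ 2 ≤ inner ℝ ((ζ - gradF (x k)) - (y - x k)) (p - y) := by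
    rw [← real_inner_self_eq_norm_sq]
    rw [← neg_sub p y, inner_neg_right] at h4
    simp only [inner_sub_left, inner_sub_right] at h3 h4 ⊢
    linarith
  have h6 : ‖(ζ - gradF (x k)) - (y - x k)‖ ≤ N * (gradErrConst N L Lm * σ) + N * σ :=
    (norm_sub_le _ _).trans (add_le_add h1 h2)
  have h7 : ‖p - y‖ ≤ N * (gradErrConst N L Lm * σ) + N * σ := by
    have h8 := h5.trans ((real_inner_le_norm _ _).trans
      (mul_le_mul_of_nonneg_right h6 (norm_nonneg _)))
    rcases (norm_nonneg (p - y)).eq_or_lt with h0 | h0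
    · rw [← h0]
      positivity
    · rw [sq] at h8
      exact le_of_mul_le_mul_right h8 h0
  have h9 : ‖x k - p‖ ≤ ‖p - y‖ + ‖y - x k‖ := by
    rw [norm_sub_rev]
    exact norm_sub_le_norm_sub_add_norm_sub _ _ _
  refine (h9.trans (add_le_add h7 h2)).trans (le_of_eq ?_)
  rw [residualConst]
  ring

/-- The coefficient of the squared step lengths in the contraction over a window, when the reference
point is within `c` times the step lengths. -/
def contractionConst (N B D : ℕ) (L Lm : ℝ≥0) (c : ℝ) : ℝ :=
  B * (gradErrConst N L Lm * (c + 1) + 2 * N ^ 3 * L + delayConst N D L) + N ^ 3 * L * c ^ 2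

lemma contractionConst_nonneg (N B D : ℕ) (L Lm : ℝ≥0) {c : ℝ} (hc : 0 ≤ c) :
    0 ≤ contractionConst N B D L Lm c := by
  have := gradErrConst_nonneg N L Lm
  have := delayConst_nonneg N D L
  unfold contractionConst
  positivity

/-- Contraction towards the value at a nearby point `y`. The first response of each agent, compared
with the block of `y`, decreases the convex model of the objective at time `k` by a fraction `γ` of
its gap; the later steps of the window increase the objective by second-order terms only. -/
lemma IsResponseSeq.V_add_le (h : IsResponseSeq s γ a d x z) (hA : P.AssumptionA x0)
    (hC : AssumptionC s τ Li) (hQ : Confinement s x0 L Q W) (hD : AssumptionD P B D a d)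
    (hγ : 0 ≤ γ) (hγ1 : γ ≤ 1) (hx : ∀ k, x k ∈ Q) {Lm : ℝ≥0} {k : ℕ} {t : Fin N → ℕ}
    {zi ξ : ∀ i, P.Blk i}
    (hfirst : ∀ i, IsFirstResponse s γ L Lm B D a x z k i (t i) (zi i) (ξ i)) {y : P.Vec}
    (hy : y ∈ P.feas) (hseg : segment ℝ (x k) y ⊆ W) {c : ℝ} (hc : 0 ≤ c)
    (hxy : ‖x k - y‖ ≤ c * windowLen B D x z k) :
    P.V (x (k + B)) - P.V y ≤ (1 - γ) * (P.V (x k) - P.V y)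
      + γ * contractionConst N B D L Lm c * windowLen B D x z k ^ 2 := by
  set σ := windowLen B D x z k with hσ
  have hσ0 : 0 ≤ σ := windowLen_nonneg k
  have hE := gradErrConst_nonneg N L Lm
  have hdel := delayConst_nonneg N D L
  set m : Fin N → ℝ := fun i =>
    inner ℝ (gradF (x k) i) (y i - x k i) + P.g i (y i) - P.g i (x k i) with hm
  set e : ℝ := gradErrConst N L Lm * (c + 1) + 2 * N ^ 3 * L + delayConst N D L with he
  have he0 : 0 ≤ e := by positivity
  have hgain : ∀ i, P.V (x (t i + 1)) - P.V (x (t i)) ≤ γ * m i + γ * e * σ ^ 2 := fun i => by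
    have hf := hfirst i
    have h1 := hf.optimal (y i) (hy i)
    have hyz : ‖y i - zi i‖ ≤ (c + 1) * σ := by
      have e1 : y i - zi i = -(x k - y) i - (zi i - x k i) := by
        simp
      rw [e1]
      refine (norm_sub_le _ _).trans ?_
      rw [norm_neg]
      linarith [PiLp.norm_apply_le (x k - y) i, hf.norm_sub]
    have h2 := (real_inner_le_norm (ξ i - gradF (x k) i) (y i - zi i)).trans
      (mul_le_mul hf.grad_err hyz (norm_nonneg _) (by positivity))
    have h3 : inner ℝ (gradF (x k) i) (zi i - x k i) + inner ℝ (gradF (x k) i) (y i - zi i) =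
        inner ℝ (gradF (x k) i) (y i - x k i) := by
      rw [← inner_add_right]
      congr 1
      abel
    rw [inner_sub_left] at h2
    have h4 : inner ℝ (gradF (x k) i) (zi i - x k i) + P.g i (zi i) - P.g i (x k i) ≤
        m i + gradErrConst N L Lm * (c + 1) * σ ^ 2 := by
      rw [hm]
      linarith
    have h5 := mul_le_mul_of_nonneg_left h4 hγ
    have h6 : 0 ≤ γ * delayConst N D L * σ ^ 2 := by positivity
    have h7 := hf.gain
    rw [he]
    linarith
  have hother : ∀ r, k ≤ r → r < k + B → P.V (x (r + 1)) - P.V (x r) ≤ γ * e * σ ^ 2 := by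
    intro r hr1 hr2
    have h1 := h.V_succ_le hA hC hQ hD hγ hγ1 (k := r) fun m _ => hx m
    have h2 : 0 ≤ γ * τ * stepLen D x z (r + D) ^ 2 := by
      have := hC.tau_pos
      positivity
    have h3 : ∑ j ∈ Finset.range (D + 1), stepLen D x z (r + j) ^ 2 ≤ σ ^ 2 := by
      refine (Finset.sum_sq_le_sq_sum_of_nonneg fun _ _ => stepLen_nonneg _).trans ?_
      exact pow_le_pow_left₀ (sum_stepLen_nonneg _ _) (sum_stepLen_mono hr1 (by omega)) 2
    have h4 : γ ^ 2 * delayConst N D L * ∑ j ∈ Finset.range (D + 1), stepLen D x z (r + j) ^ 2 ≤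
        γ * e * σ ^ 2 := by
      have e2 : γ ^ 2 ≤ γ := by nlinarith
      have e3 : delayConst N D L ≤ e := by
        rw [he]
        have : 0 ≤ gradErrConst N L Lm * (c + 1) + 2 * N ^ 3 * L := by positivity
        linarith
      gcongr
    linarith
  have hstep : ∀ r ∈ Finset.Ico k (k + B), P.V (x (r + 1)) - P.V (x r) ≤
      γ * e * σ ^ 2 + ∑ i, if r = t i then γ * m i else 0 := by
    intro r hr
    rw [Finset.mem_Ico] at hr
    by_cases hrt : r = t (a r)
    · have h1 : ∑ i, (if r = t i then γ * m i else 0) = γ * m (a r) := by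
        rw [Finset.sum_eq_single (a r)]
        · rw [if_pos hrt]
        · intro i _ hi
          rw [if_neg]
          rintro rfl
          exact hi (hfirst i).agent.symm
        · simp
      have h2 := hgain (a r)
      rw [← hrt] at h2
      rw [h1]
      linarith
    · have h1 : ∑ i, (if r = t i then γ * m i else 0) = 0 := by
        refine Finset.sum_eq_zero fun i _ => if_neg ?_
        rintro rfl
        exact hrt (by rw [(hfirst i).agent])
      rw [h1, add_zero]
      exact hother r hr.1 hr.2
  have htel : ∑ r ∈ Finset.Ico k (k + B), (P.V (x (r + 1)) - P.V (x r)) =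
      P.V (x (k + B)) - P.V (x k) :=
    Finset.sum_Ico_sub (fun r => P.V (x r)) (Nat.le_add_right k B)
  have hsum := Finset.sum_le_sum hstep
  rw [htel, Finset.sum_add_distrib, Finset.sum_const, Nat.card_Ico, Nat.add_sub_cancel_left,
    Finset.sum_comm] at hsum
  have hswap : ∑ i, ∑ r ∈ Finset.Ico k (k + B), (if r = t i then γ * m i else 0) =
      γ * ∑ i, m i := by
    rw [Finset.mul_sum]
    refine Finset.sum_congr rfl fun i _ => ?_
    rw [Finset.sum_ite_eq', if_pos (Finset.mem_Ico.2 ⟨(hfirst i).le, (hfirst i).lt⟩)]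
  rw [hswap, nsmul_eq_mul] at hsum
  have hmsum : ∑ i, m i = inner ℝ (gradF (x k)) (y - x k) + P.G y - P.G (x k) := by
    rw [PiLp.inner_apply, G, G, ← Finset.sum_add_distrib, ← Finset.sum_sub_distrib]
    rfl
  have hF := (neg_abs_le _).trans' (neg_le_neg (hQ.abs_F_sub_le hA hseg))
  have hsq : (N : ℝ) ^ 3 * L * ‖y - x k‖ ^ 2 ≤ N ^ 3 * L * c ^ 2 * σ ^ 2 := by
    rw [mul_assoc _ (c ^ 2), ← mul_pow, norm_sub_rev]
    exact mul_le_mul_of_nonneg_left (pow_le_pow_left₀ (norm_nonneg _) hxy 2) (by positivity)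
  have hmle : ∑ i, m i ≤ P.V y - P.V (x k) + N ^ 3 * L * c ^ 2 * σ ^ 2 := by
    rw [hmsum, V, V]
    linarith
  have hfin := mul_le_mul_of_nonneg_left hmle hγ
  rw [contractionConst, ← he]
  linarith

/-- The objective at `u` is at most a second-order term below its value at a stationary point. -/
lemma Confinement.neg_le_V_sub (hQ : Confinement s x0 L Q W) (hA : P.AssumptionA x0)
    {u y : P.Vec} (hu : u ∈ P.feas) (hy : y ∈ P.stat) (hseg : segment ℝ u y ⊆ W) :
    -(N ^ 3 * L * ‖u - y‖ ^ 2) ≤ P.V u - P.V y := by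
  rw [segment_symm] at hseg
  have hF := (neg_abs_le _).trans' (neg_le_neg (hQ.abs_F_sub_le hA hseg))
  have hst := ((mem_stat_iff hA.smoothF).1 hy).2 u hu
  rw [V, V]
  linarith

end Window

end PartitionedProblem

/-! ### The claimed rate and the threshold for the stepsize -/

namespace RateData

variable {q : RateData}

/-- The claimed rate lies strictly between zero and one, and it is at least as close to one as
`1 - γ ^ 2 τ / (2 N L)`. -/
lemma lam_bounds (hN : 1 ≤ q.N) (hB : q.N ≤ q.B) (hD : 0 ≤ q.D) (hrho : 1 ≤ q.rho) (hL : 0 < q.L)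
    (hLm : 0 ≤ q.Lm) (hγ : 0 < q.gamma) (hγ1 : q.gamma ≤ 1)
    (hsmall : q.gamma * q.L * (q.B * q.D * q.rho ^ 2 + 2) < 2 * q.tau) :
    0 < q.lam ∧ q.lam < 1 ∧ 1 - q.lam ≤ q.gamma ^ 2 * q.tau / (2 * q.N * q.L) := by
  have hN0 : 0 < q.N := by linarith
  have hBN : 0 ≤ q.B - q.N := by linarith
  have hB0 : 0 ≤ q.B := by linarith
  have hrho0 : 0 ≤ q.rho - 1 := by linarith
  have hrho1 : 0 < q.rho := by linarith
  have hγ' : 0 ≤ 1 - q.gamma := by linarith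
  have hC2 : 0 ≤ q.C2 := by
    have : 0 ≤ q.B + 2 * q.D - q.N + 1 := by linarith
    unfold C2
    positivity
  have hK : 0 ≤ q.K := by
    unfold K
    positivity
  have hb1 : 1 ≤ q.beta1 := by
    have h1 : 0 ≤ q.C2 * (q.K * (2 * q.N + 1) + q.N * (1 + q.gamma ^ 2)) := by positivity
    have h2 : 0 ≤ q.gamma ^ 2 * (q.B - q.N + 2) := by positivity
    unfold beta1
    linarith
  have hb2 : 0 ≤ q.beta2 := by
    have : 0 ≤ 3 * q.B - 3 * q.N + 5 := by linarith
    unfold beta2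
    positivity
  have hb3 : 0 ≤ q.beta3 := by
    unfold beta3
    positivity
  have hb4 : 0 ≤ q.beta4 := by
    unfold beta4
    positivity
  have hb5 : 0 ≤ q.beta5 := by
    unfold beta5
    positivity
  have hcommon : 0 ≤ (1 - q.gamma) *
      (q.beta3 + (q.L * q.gamma * (q.rho ^ 2 * q.L * q.D ^ 2 * q.gamma + 1) + 1) / 2) := by
    positivity
  have ha1 : q.L ≤ q.alpha1 := by
    have h1 : q.L * 1 ≤ q.L * (q.rho * q.beta1) :=
      mul_le_mul_of_nonneg_left (one_le_mul_of_one_le_of_one_le hrho hb1) hL.le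
    unfold alpha1
    linarith
  have ha2 : 0 ≤ q.alpha2 := by
    unfold alpha2
    positivity
  have he : 0 < q.slack := by
    unfold slack
    linarith
  have he2 : q.slack ≤ 2 * q.tau := by
    have : 0 ≤ q.gamma * q.L * (q.B * q.D * q.rho ^ 2 + 2) := by positivity
    unfold slack
    linarith
  set den := 2 * q.N * q.alpha1 + 2 * (q.B - q.N) * q.alpha2 + q.gamma * (2 - q.gamma) * q.slack
    with hden
  have h1 : 2 * q.N * q.L ≤ 2 * q.N * q.alpha1 := mul_le_mul_of_nonneg_left ha1 (by positivity)
  have h2 : 0 ≤ 2 * (q.B - q.N) * q.alpha2 := by positivity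
  have h3 : q.gamma * q.slack ≤ q.gamma * (2 - q.gamma) * q.slack := by
    refine mul_le_mul_of_nonneg_right ?_ he.le
    nlinarith
  have hNL : 0 < 2 * q.N * q.L := by positivity
  have hγe : 0 < q.gamma * q.slack := mul_pos hγ he
  have hden1 : 2 * q.N * q.L ≤ den := by linarith
  have hden2 : q.gamma * q.slack < den := by linarith
  have hden0 : 0 < den := by linarith
  have hlam : q.lam = 1 - q.gamma ^ 2 / 2 * (q.slack / den) := rfl
  have hpos : 0 < q.gamma ^ 2 / 2 * (q.slack / den) := by positivity
  refine ⟨?_, by linarith, ?_⟩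
  · have h4 : q.gamma ^ 2 / 2 * (q.slack / den) < 1 := by
      rw [← mul_div_assoc, div_lt_one hden0]
      nlinarith
    linarith
  · rw [hlam, sub_sub_cancel]
    have h5 : q.slack / den ≤ 2 * q.tau / (2 * q.N * q.L) :=
      div_le_div₀ (by linarith) he2 hNL hden1
    refine (mul_le_mul_of_nonneg_left h5 (by positivity)).trans (le_of_eq ?_)
    ring

end RateData

namespace PartitionedProblem

variable {N : ℕ} {P : PartitionedProblem N}

/-- Bound for the distance to the stationary set, relative to the step lengths in a window. -/
def statDistConst (N : ℕ) (L Lm : ℝ≥0) (κ : ℝ) : ℝ := 2 * κ * residualConst N L Lm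

lemma statDistConst_nonneg (N : ℕ) (L Lm : ℝ≥0) {κ : ℝ} (hκ : 0 ≤ κ) :
    0 ≤ statDistConst N L Lm κ := by
  have := residualConst_nonneg N L Lm
  unfold statDistConst
  positivity

/-- The total coefficient of the squared steps in the contraction of the energy. -/
def energyConst (N B D : ℕ) (L Lm : ℝ≥0) (κ : ℝ) : ℝ :=
  contractionConst N B D L Lm (statDistConst N L Lm κ) * (D + B) + delayConst N D L * D

lemma energyConst_nonneg (N B D : ℕ) (L Lm : ℝ≥0) {κ : ℝ} (hκ : 0 ≤ κ) :
    0 ≤ energyConst N B D L Lm κ := by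
  have := contractionConst_nonneg N B D L Lm (statDistConst_nonneg N L Lm hκ)
  have := delayConst_nonneg N D L
  unfold energyConst
  positivity

/-- The threshold for `γ / τ`. The three terms beside `1` in the denominator make the numerator of the
rate positive, make the energy decrease, and make the energy contract at the claimed rate. -/
def stepThreshold (N B D ρ : ℕ) (L Lm : ℝ≥0) (κ : ℝ) : ℝ :=
  (1 + L * (B * D * ρ ^ 2 + 2) + 2 * (delayConst N D L * (D + 1)) +
    (D + B) * (N * (Lm + L)) * (N * (Lm + L) + 2 * energyConst N B D L Lm κ) / L)⁻¹

section Threshold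

variable {B D ρ : ℕ} {L Lm : ℝ≥0} {κ γ τ : ℝ}

lemma stepThreshold_pos (hκ : 0 ≤ κ) : 0 < stepThreshold N B D ρ L Lm κ := by
  have := energyConst_nonneg N B D L Lm hκ
  have := delayConst_nonneg N D L
  unfold stepThreshold
  positivity

/-- What a stepsize below the threshold satisfies. -/
lemma bounds_of_lt_stepThreshold (hL : 0 < L) (hκ : 0 ≤ κ) (hτ : 0 < τ) (hγ : 0 < γ)
    (h : γ / τ < stepThreshold N B D ρ L Lm κ) :
    γ * L * (B * D * ρ ^ 2 + 2) < 2 * τ ∧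
    γ * (delayConst N D L * (D + 1)) ≤ τ / 2 ∧
    γ * ((D + B) * (N * (Lm + L)) * (N * (Lm + L) + 2 * energyConst N B D L Lm κ)) ≤ τ * L := by
  have hE := energyConst_nonneg N B D L Lm hκ
  have hd := delayConst_nonneg N D L
  have hL' : (0 : ℝ) < L := hL
  set X : ℝ := L * (B * D * ρ ^ 2 + 2) with hX
  set Y : ℝ := delayConst N D L * (D + 1) with hY
  set Z : ℝ := (D + B) * (N * (Lm + L)) * (N * (Lm + L) + 2 * energyConst N B D L Lm κ) with hZ
  have hX0 : 0 ≤ X := by positivity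
  have hY0 : 0 ≤ Y := by positivity
  have hZ0 : 0 ≤ Z := by positivity
  have hZL : 0 ≤ Z / L := by positivity
  have h1 : γ * (1 + X + 2 * Y + Z / L) < τ := by
    have hpos : 0 < 1 + X + 2 * Y + Z / L := by positivity
    have h2 : γ / τ < (1 + X + 2 * Y + Z / L)⁻¹ := h
    rw [div_lt_iff₀ hτ, inv_mul_eq_div, lt_div_iff₀ hpos] at h2
    exact h2
  have g1 : 0 ≤ γ * X := by positivity
  have g2 : 0 ≤ γ * Y := by positivity
  have g3 : 0 ≤ γ * (Z / L) := by positivity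
  refine ⟨?_, ?_, ?_⟩
  · rw [mul_assoc]
    linarith
  · linarith
  · have h3 : γ * (Z / L) ≤ τ := by linarith
    rw [← mul_div_assoc, div_le_iff₀ hL'] at h3
    exact h3

lemma one_le_rho (hN : 0 < N) : 1 ≤ P.rho := by
  have h1 : 1 ≤ (P.Nb ⟨0, hN⟩).card := Finset.card_pos.2 ⟨_, P.self_mem _⟩
  exact h1.trans (Finset.le_sup (f := fun i => (P.Nb i).card) (Finset.mem_univ _))

/-- Since `1 - λ` is quadratic in `γ` and the true contraction per window is linear in `γ`, the
claimed rate is attained for small `γ`; here `τ ≤ N (Lm + L)` turns smallness of `γ / τ` into smallness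
of `γ`. -/
lemma one_sub_div_le_pow {lam : ℝ} (hN : 1 ≤ N) (hL : 0 < L) (hκ : 0 ≤ κ) (hτ : 0 < τ) (hγ : 0 < γ)
    (hγ1 : γ ≤ 1) (hτL : τ ≤ N * (Lm + L)) (hl0 : 0 < lam)
    (hlam : 1 - lam ≤ γ ^ 2 * τ / (2 * N * L))
    (hγE : γ * ((D + B) * (N * (Lm + L)) * (N * (Lm + L) + 2 * energyConst N B D L Lm κ)) ≤ τ * L) :
    1 - γ / (1 + (γ * contractionConst N B D L Lm (statDistConst N L Lm κ) * (D + B)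
      + γ ^ 2 * delayConst N D L * D) * (2 / (γ * τ))) ≤ lam ^ (D + B) := by
  have hL' : (0 : ℝ) < L := hL
  have hN' : (1 : ℝ) ≤ N := by exact_mod_cast hN
  have hE := energyConst_nonneg N B D L Lm hκ
  have hd := delayConst_nonneg N D L
  have hcc := contractionConst_nonneg N B D L Lm (statDistConst_nonneg N L Lm hκ)
  set A : ℝ := (γ * contractionConst N B D L Lm (statDistConst N L Lm κ) * (D + B)
      + γ ^ 2 * delayConst N D L * D) * (2 / (γ * τ)) with hA
  set R : ℝ := N * (Lm + L) with hR
  set E := energyConst N B D L Lm κ with hEdef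
  have hA0 : 0 ≤ A := by positivity
  have hτA : τ * A ≤ 2 * E := by
    have h1 : τ * A = 2 * (contractionConst N B D L Lm (statDistConst N L Lm κ) * (D + B)
        + γ * (delayConst N D L * D)) := by
      rw [hA]
      field_simp
    have h2 : γ * (delayConst N D L * D) ≤ delayConst N D L * D :=
      mul_le_of_le_one_left (by positivity) hγ1
    rw [h1, hEdef, energyConst]
    linarith
  have hbern : 1 - ((D + B : ℕ) : ℝ) * (1 - lam) ≤ lam ^ (D + B) := by
    have := one_add_mul_le_pow (a := lam - 1) (by linarith) (D + B)
    rw [add_sub_cancel] at this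
    linarith
  refine le_trans ?_ hbern
  have hT : ((D + B : ℕ) : ℝ) = D + B := by push_cast; rfl
  rw [hT]
  have hT0 : (0 : ℝ) ≤ D + B := by positivity
  have h1 : ((D : ℝ) + B) * (1 - lam) ≤ (D + B) * (γ ^ 2 * τ / (2 * N * L)) :=
    mul_le_mul_of_nonneg_left hlam hT0
  have h2 : ((D : ℝ) + B) * (γ ^ 2 * τ / (2 * N * L)) ≤ γ / (1 + A) := by
    have h3 : τ * (1 + A) ≤ R + 2 * E := by linarith
    have hden : (0 : ℝ) < 2 * N * L := by positivity
    rw [← mul_div_assoc, div_le_div_iff₀ hden (by linarith)]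
    have h4 : γ * ((D + B) * R * (τ * (1 + A))) ≤ τ * L := by
      refine le_trans ?_ hγE
      gcongr
    have h5 : γ * ((D + B) * (τ * (1 + A))) ≤ L := by
      have h6 : τ * (γ * ((D + B) * (τ * (1 + A)))) ≤ τ * L := by
        refine le_trans ?_ h4
        have : 0 ≤ γ * ((D + B) * (τ * (1 + A))) := by positivity
        nlinarith
      exact le_of_mul_le_mul_left h6 hτ
    have h7 : (L : ℝ) ≤ 2 * N * L := by nlinarith
    calc ((D : ℝ) + B) * (γ ^ 2 * τ) * (1 + A) = γ * (γ * ((D + B) * (τ * (1 + A)))) := by ring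
      _ ≤ γ * (2 * N * L) := mul_le_mul_of_nonneg_left (h5.trans h7) hγ.le
  linarith

end Threshold

/-! ### Convergence of a run -/

section Convergence

variable {s : P.Surrogates} {τ γ ε η κ : ℝ} {Li : Fin N → ℝ≥0}
  {x0 : P.Vec} {L : ℝ≥0} {Q W : Set P.Vec} {B D : ℕ} {a : ℕ → Fin N}
  {d : ℕ → Fin N → Fin N → Fin N → ℕ} {x : ℕ → P.Vec} {z : ∀ k, P.Blk (a k)}

lemma tendsto_windowLen (hlim : Tendsto (stepLen D x z) atTop (𝓝 0)) :
    Tendsto (windowLen B D x z) atTop (𝓝 0) := by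
  have : Tendsto (windowLen B D x z) atTop (𝓝 (∑ _j ∈ Finset.range (D + B), (0 : ℝ))) :=
    tendsto_finsetSum _ fun j _ => hlim.comp (tendsto_add_atTop_nat j)
  simpa using this

/-- The iterates eventually have stationary points nearby, all with the same objective value: the
nearby stationary points move less and less, and stationary values are separated. -/
lemma IsResponseSeq.exists_near_stat (h : IsResponseSeq s γ a d x z) (hA : P.AssumptionA x0)
    (hB2 : P.AssumptionB2) (hC : AssumptionC s τ Li) (hQ : Confinement s x0 L Q W)
    (hD : AssumptionD P B D a d) (hEB : P.ErrorBound η ε κ) (hε : 0 < ε) (hκ : 0 < κ)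
    (hη : P.V x0 ≤ η) (hγ : 0 < γ) (hγ1 : γ ≤ 1) (hx : ∀ k, x k ∈ P.level x0)
    (hlim : Tendsto (stepLen D x z) atTop (𝓝 0)) :
    ∃ (k₀ : ℕ) (y : ℕ → P.Vec) (Vs : ℝ), ∀ k, k₀ ≤ k → y k ∈ P.stat ∧ P.V (y k) = Vs ∧
      ‖x k - y k‖ ≤ statDistConst N L (Finset.univ.sup Li) κ * windowLen B D x z k ∧
      segment ℝ (x k) (y k) ⊆ W := by
  set c := statDistConst N L (Finset.univ.sup Li) κ with hc
  have hc0 : 0 ≤ c := statDistConst_nonneg _ _ _ hκ.le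
  have hxQ : ∀ k, x k ∈ Q := fun k => hQ.level_subset (hx k)
  have hσ := tendsto_windowLen (B := B) hlim
  obtain ⟨ψ, hψ, hnear⟩ := hQ.near
  have e1 : ∀ᶠ k in atTop,
      residualConst N L (Finset.univ.sup Li) * windowLen B D x z k < ε := by
    have := hσ.const_mul (residualConst N L (Finset.univ.sup Li))
    rw [mul_zero] at this
    exact this.eventually_lt_const hε
  have hcσ : Tendsto (fun k => c * windowLen B D x z k) atTop (𝓝 0) := by
    simpa using hσ.const_mul c
  have e2 : ∀ᶠ k in atTop, c * windowLen B D x z k < ψ := hcσ.eventually_lt_const hψ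
  obtain ⟨k₁, hk₁⟩ := eventually_atTop.1 (e1.and e2)
  have hy : ∀ k, k₁ ≤ k → ∃ y, y ∈ P.stat ∧ ‖x k - y‖ ≤ c * windowLen B D x z k := by
    intro k hk
    choose t zi ξ hfirst using h.exists_isFirstResponse hA hC hQ hD hγ.le hγ1 hxQ k
    obtain ⟨p, hp⟩ := hA.exists_isProx (x k - gradF (x k))
    have hr := norm_sub_prox_le hA hfirst hp
    obtain ⟨y, hy, hxy⟩ := hEB.exists_mem_stat hA hκ (hx k).1 ((hx k).2.trans hη) hp
      (hr.trans (hk₁ k hk).1.le)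
    refine ⟨y, hy, hxy.trans ?_⟩
    rw [hc, statDistConst, mul_assoc (2 * κ)]
    exact mul_le_mul_of_nonneg_left hr (by positivity)
  choose! y hystat hyx using hy
  obtain ⟨δ, hδ, hsep⟩ := hB2
  have e3 : ∀ᶠ k in atTop, c * windowLen B D x z k + γ * stepLen D x z (k + D) +
      c * windowLen B D x z (k + 1) < δ := by
    have h1 := (hcσ.add ((hlim.comp (tendsto_add_atTop_nat D)).const_mul γ)).add
      (hcσ.comp (tendsto_add_atTop_nat 1))
    simp only [mul_zero, add_zero] at h1
    exact h1.eventually_lt_const hδ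
  obtain ⟨k₂, hk₂⟩ := eventually_atTop.1 e3
  have hVsucc : ∀ k, max k₁ k₂ ≤ k → P.V (y (k + 1)) = P.V (y k) := by
    intro k hk
    by_contra hne
    have hk1 : k₁ ≤ k := (le_max_left _ _).trans hk
    have h1 := hsep _ (hystat k hk1) _ (hystat (k + 1) (by omega)) (Ne.symm hne)
    have h2 := hyx k hk1
    have h3 := hyx (k + 1) (by omega)
    have h4 := h.dist_succ_le (D := D) hγ.le (k + D)
    rw [show k + D - D = k by omega, show k + D + 1 - D = k + 1 by omega, dist_eq_norm] at h4
    have h5 : ‖y k - y (k + 1)‖ ≤ ‖x k - y k‖ + ‖x k - x (k + 1)‖ + ‖x (k + 1) - y (k + 1)‖ := by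
      have e : y k - y (k + 1) = -(x k - y k) + (x k - x (k + 1)) + (x (k + 1) - y (k + 1)) := by
        abel
      rw [e]
      refine norm_add₃_le.trans (le_of_eq ?_)
      rw [norm_neg]
    have h6 := hk₂ k ((le_max_right _ _).trans hk)
    linarith
  have hVconst : ∀ k, max k₁ k₂ ≤ k → P.V (y k) = P.V (y (max k₁ k₂)) := by
    intro k hk
    induction k, hk using Nat.le_induction with
    | base => rfl
    | succ k hk ih => rw [hVsucc k hk, ih]
  refine ⟨max k₁ k₂, y, P.V (y (max k₁ k₂)), fun k hk => ?_⟩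
  have hk1 : k₁ ≤ k := (le_max_left _ _).trans hk
  refine ⟨hystat k hk1, hVconst k hk, hyx k hk1, ?_⟩
  refine segment_subset_of_block_bound hA (hx k).1 (hystat k hk1).1 (r := ψ) (fun i => ?_)
    fun u hu hux => hnear (x k) (hxQ k) u hu hux
  have h1 := PiLp.norm_apply_le (x k - y k) i
  rw [PiLp.sub_apply, norm_sub_rev] at h1
  exact (h1.trans (hyx k hk1)).trans (hk₁ k hk1).2.le

/-- Linear convergence of a run, in terms of all its iterates. -/
theorem IsResponseSeq.exists_linear_rate (h : IsResponseSeq s γ a d x z) (hA : P.AssumptionA x0)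
    (hB2 : P.AssumptionB2) (hC : AssumptionC s τ Li) (hQ : Confinement s x0 L Q W)
    (hD : AssumptionD P B D a d) (hEB : P.ErrorBound η ε κ) (hε : 0 < ε) (hκ : 0 < κ)
    (hη : P.V x0 ≤ η) (hx0 : x 0 = x0) (hf : x0 ∈ P.feas) (hL : 0 < L) (hγ : 0 < γ) (hγ1 : γ ≤ 1)
    (hsmall : γ * (delayConst N D L * (D + 1)) ≤ τ / 2)
    (hγE : γ * ((D + B) * (N * ((Finset.univ.sup Li : ℝ≥0) + L)) *
      (N * ((Finset.univ.sup Li : ℝ≥0) + L) + 2 * energyConst N B D L (Finset.univ.sup Li) κ)) ≤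
        τ * L)
    {lam : ℝ} (hl0 : 0 < lam) (hl1 : lam < 1) (hlam : 1 - lam ≤ γ ^ 2 * τ / (2 * N * L)) :
    ∃ xs ∈ P.stat, ∃ M, ∀ k, |P.V (x k) - P.V xs| ≤ M * lam ^ k ∧
      ‖x k - xs‖ ≤ M * Real.sqrt (lam ^ k) := by
  have hτ := hC.tau_pos
  have hN : 1 ≤ N := (Nat.zero_le _).trans_lt (a 0).2
  have hB : 0 < B := lt_of_lt_of_le hN hD.le_B
  have hb : 0 ≤ γ ^ 2 * delayConst N D L := mul_nonneg (sq_nonneg γ) (delayConst_nonneg N D L)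
  have hsmall' : γ ^ 2 * delayConst N D L * (D + 1) ≤ γ * τ / 2 := by
    have := mul_le_mul_of_nonneg_left hsmall hγ.le
    linarith
  have hx := h.mem_level hA hC hQ hD hx0 hf hγ.le hγ1 hsmall'
  have hxQ : ∀ k, x k ∈ Q := fun k => hQ.level_subset (hx k)
  have hlim := h.tendsto_stepLen hA hC hQ hD hx hγ hγ1 hsmall'
  obtain ⟨k₀, y, Vs, hy⟩ := h.exists_near_stat hA hB2 hC hQ hD hEB hε hκ hη hγ hγ1 hx hlim
  set c := statDistConst N L (Finset.univ.sup Li) κ with hc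
  have hc0 : 0 ≤ c := statDistConst_nonneg _ _ _ hκ.le
  by_cases hmove : ∃ k, z k ≠ x k (a k)
  · -- some step is nontrivial, which bounds `τ`
    obtain ⟨m, hm⟩ := hmove
    have hτL : τ ≤ N * ((Finset.univ.sup Li : ℝ≥0) + L) := by
      have h1 := hQ.tau_le hC (hQ.subset (hxQ m)) (h.isBestResponse m).1
        (h.mem_of_norm_le hQ (fun m _ => hxQ m) (hxQ m)
          (replaceBlock_mem_feas (hx m).1 (h.isBestResponse m).1)
          fun j => norm_replaceBlock_sub_apply_le _ _ _ j) hm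
      have h2 : (Li (a m) : ℝ) ≤ ((Finset.univ.sup Li : ℝ≥0) : ℝ) := by
        exact_mod_cast Finset.le_sup (f := Li) (Finset.mem_univ _)
      refine h1.trans ?_
      gcongr
    set q : ℕ → ℝ := fun m => stepLen D x z m ^ 2 with hq
    set cc := contractionConst N B D L (Finset.univ.sup Li) c with hcc
    have hcc0 : 0 ≤ cc := contractionConst_nonneg _ _ _ _ _ hc0
    have hσq : ∀ k, windowLen B D x z k ^ 2 ≤
        ((D : ℝ) + B) * ∑ j ∈ Finset.range (D + B), q (k + j) := fun k => by
      have := sq_sum_stepLen_le (D := D) (x := x) (z := z) k (D + B)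
      push_cast at this
      exact this
    obtain ⟨M, hM, hrate⟩ := linear_rate_of_delayed_descent (D := D) (B := B) (k₀ := k₀)
      (v := fun k => P.V (x k) - Vs) (q := q) (p := γ * τ) (b := γ ^ 2 * delayConst N D L)
      (γ := γ) (C := γ * cc * (D + B)) (C' := N ^ 3 * L * c ^ 2 * (D + B)) (lam := lam)
      (fun m => sq_nonneg _)
      (fun m hm => by simp [hq, stepLen_of_lt hm]) hB hγ1 (mul_pos hγ hτ) hb (by positivity) hsmall'
      (fun k => by
        have := h.V_succ_le hA hC hQ hD hγ.le hγ1 (k := k) fun m _ => hxQ m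
        simp only [hq]
        linarith)
      (fun k hk => by
        obtain ⟨h1, h2, h3, h4⟩ := hy k hk
        choose t zi ξ hfirst using h.exists_isFirstResponse hA hC hQ hD hγ.le hγ1 hxQ k
        have h5 := h.V_add_le hA hC hQ hD hγ.le hγ1 hxQ hfirst h1.1 h4 hc0 h3
        rw [h2] at h5
        have h6 := mul_le_mul_of_nonneg_left (hσq k) (mul_nonneg hγ.le hcc0)
        linarith)
      (fun k hk => by
        obtain ⟨h1, h2, h3, h4⟩ := hy k hk
        have h5 := hQ.neg_le_V_sub hA (hx k).1 h1 h4
        rw [h2] at h5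
        have h6 : (N : ℝ) ^ 3 * L * ‖x k - y k‖ ^ 2 ≤
            N ^ 3 * L * (c * windowLen B D x z k) ^ 2 :=
          mul_le_mul_of_nonneg_left (pow_le_pow_left₀ (norm_nonneg _) h3 2) (by positivity)
        have h7 := mul_le_mul_of_nonneg_left (hσq k)
          (by positivity : (0 : ℝ) ≤ N ^ 3 * L * c ^ 2)
        linarith)
      (by simpa using hlim.pow 2) hl0 hl1
      (one_sub_div_le_pow hN hL hκ.le hτ hγ hγ1 hτL hl0 hlam hγE)
    set r := Real.sqrt lam with hr
    have hr1 : r < 1 := by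
      rw [hr, Real.sqrt_lt' one_pos]
      simpa using hl1
    have hrpow : ∀ k, Real.sqrt (lam ^ k) = r ^ k := fun k => by
      rw [Real.sqrt_eq_iff_mul_self_eq (by positivity) (by positivity), ← mul_pow,
        Real.mul_self_sqrt hl0.le]
    have hdist : ∀ k, dist (x k) (x (k + 1)) ≤ Real.sqrt M * r ^ k := fun k => by
      have h1 := h.dist_succ_le (D := D) hγ.le (k + D)
      rw [show k + D - D = k by omega, show k + D + 1 - D = k + 1 by omega] at h1
      have h2 : stepLen D x z (k + D) ≤ Real.sqrt (M * lam ^ k) :=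
        Real.le_sqrt_of_sq_le (hrate k).2
      rw [Real.sqrt_mul hM, hrpow] at h2
      exact h1.trans ((mul_le_of_le_one_left (stepLen_nonneg _) hγ1).trans h2)
    obtain ⟨xs, hxs⟩ := cauchySeq_tendsto_of_complete (cauchySeq_of_le_geometric r _ hr1 hdist)
    have hxd := dist_le_of_le_geometric_of_tendsto r _ hr1 hdist hxs
    have hylim : Tendsto y atTop (𝓝 xs) := by
      have h1 : Tendsto (fun k => c * windowLen B D x z k) atTop (𝓝 0) := by
        simpa using (tendsto_windowLen (B := B) hlim).const_mul c
      have h2 : Tendsto (fun k => x k - y k) atTop (𝓝 0) := by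
        refine squeeze_zero_norm' ?_ h1
        filter_upwards [eventually_ge_atTop k₀] with k hk
        exact (hy k hk).2.2.1
      simpa using hxs.sub h2
    have hstat : xs ∈ P.stat := hA.isClosed_stat.mem_of_tendsto hylim (by
      filter_upwards [eventually_ge_atTop k₀] with k hk
      exact (hy k hk).1)
    have hVs : P.V xs = Vs := by
      obtain ⟨δ, hδ, hsep⟩ := hB2
      have h1 : ∀ᶠ k in atTop, dist (y k) xs < δ := hylim (Metric.ball_mem_nhds xs hδ)
      obtain ⟨k, hk1, hk2⟩ := (h1.and (eventually_ge_atTop k₀)).exists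
      by_contra hne
      have := hsep _ (hy k hk2).1 _ hstat (by rw [(hy k hk2).2.1]; exact Ne.symm hne)
      rw [dist_eq_norm] at hk1
      linarith
    refine ⟨xs, hstat, M + Real.sqrt M / (1 - r), fun k => ⟨?_, ?_⟩⟩
    · rw [hVs]
      refine (hrate k).1.trans (mul_le_mul_of_nonneg_right ?_ (by positivity))
      have : 0 ≤ Real.sqrt M / (1 - r) := div_nonneg (Real.sqrt_nonneg _) (by linarith)
      linarith
    · rw [← dist_eq_norm, hrpow]
      refine (hxd k).trans ?_
      rw [add_mul, div_mul_eq_mul_div]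
      have : 0 ≤ M * r ^ k := by positivity
      linarith
  · -- no iterate moves, and the initial point is stationary
    push Not at hmove
    have hstep : ∀ m, stepLen D x z m = 0 := fun m => by
      rw [stepLen]
      split_ifs
      · rfl
      · rw [hmove, sub_self, norm_zero]
    have hconst : ∀ k, x k = x k₀ := by
      have h1 : ∀ k, x k = x 0 := fun k => by
        induction k with
        | zero => rfl
        | succ k ih =>
          have h1 := h.dist_succ_le (D := D) hγ.le (k + D)
          rw [show k + D - D = k by omega, show k + D + 1 - D = k + 1 by omega, hstep,
            mul_zero] at h1
          rw [← ih]
          exact (dist_le_zero.1 h1).symm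
      intro k
      rw [h1 k, h1 k₀]
    obtain ⟨h1, -, h3, -⟩ := hy k₀ le_rfl
    have hw : windowLen B D x z k₀ = 0 := Finset.sum_eq_zero fun j _ => hstep _
    rw [hw, mul_zero] at h3
    have hxy : x k₀ = y k₀ := sub_eq_zero.1 (norm_le_zero_iff.1 h3)
    refine ⟨x k₀, hxy ▸ h1, 0, fun k => ?_⟩
    rw [hconst k]
    simp

end Convergence

end PartitionedProblem

end

/-! ### Linear convergence of the asynchronous algorithm -/

/-- `c` is the smallness threshold for `γ / τ`; it depends only on the numbers
`N, B, D, ρ, L, max L_i, κ`. -/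
theorem theorem2 :
    ∃ c : ℕ → ℕ → ℕ → ℕ → ℝ≥0 → ℝ≥0 → ℝ → ℝ,
      (∀ N B D ρ L Lm κ, 0 < L → 0 < κ → 0 < c N B D ρ L Lm κ) ∧
      ∀ (N : ℕ) (P : PartitionedProblem N) (x0 : P.Vec) (s : P.Surrogates)
        (τ : ℝ) (Li : Fin N → ℝ≥0),
        x0 ∈ P.feas → P.AssumptionA x0 → P.AssumptionB1 → P.AssumptionB2 →
        PartitionedProblem.AssumptionC s τ Li →
        (∃ L : ℝ≥0, 0 < L ∧ PartitionedProblem.IsLipConst s x0 L) ∧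
        ∀ (B D : ℕ) (L : ℝ≥0) (η ε κ γ : ℝ),
          0 < L → PartitionedProblem.IsLipConst s x0 L →
          P.V x0 ≤ η → 0 < ε → 0 < κ → P.ErrorBound η ε κ →
          0 < γ → γ ≤ 1 → γ / τ < c N B D P.rho L (Finset.univ.sup Li) κ →
          ∀ (a : ℕ → Fin N) (d : ℕ → Fin N → Fin N → Fin N → ℕ) (x : ℕ → P.Vec),
            PartitionedProblem.AssumptionD P B D a d →
            PartitionedProblem.IsRun s γ a d x → x 0 = x0 →
            0 < asyncRate N B D P.rho L Li τ γ κ ∧ asyncRate N B D P.rho L Li τ γ κ < 1 ∧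
            ∃ xs ∈ P.stat, ∀ t < B,
              (fun k : ℕ => P.V (x (t + k * B)) - P.V xs) =O[atTop]
                (fun k : ℕ => asyncRate N B D P.rho L Li τ γ κ ^ (t + k * B)) ∧
              (fun k : ℕ => ‖x (t + k * B) - xs‖) =O[atTop]
                (fun k : ℕ => Real.sqrt (asyncRate N B D P.rho L Li τ γ κ ^ (t + k * B))) := by
  refine ⟨PartitionedProblem.stepThreshold,
    fun N B D ρ L Lm κ _ hκ => PartitionedProblem.stepThreshold_pos hκ.le, ?_⟩
  intro N P x0 s τ Li hf hA _ hB2 hC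
  refine ⟨PartitionedProblem.exists_isLipConst hA hC, ?_⟩
  intro B D L η ε κ γ hL hLip hη hε hκ hEB hγ hγ1 hthr a d x hD hrun hx0
  have hN : 1 ≤ N := (Nat.zero_le _).trans_lt (a 0).2
  obtain ⟨hs1, hs2, hs3⟩ := PartitionedProblem.bounds_of_lt_stepThreshold hL hκ.le hC.tau_pos hγ hthr
  obtain ⟨hl0, hl1, hlam⟩ : 0 < asyncRate N B D P.rho L Li τ γ κ ∧
      asyncRate N B D P.rho L Li τ γ κ < 1 ∧
      1 - asyncRate N B D P.rho L Li τ γ κ ≤ γ ^ 2 * τ / (2 * N * L) :=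
    RateData.lam_bounds (Nat.one_le_cast.2 hN) (Nat.cast_le.2 hD.le_B) (Nat.cast_nonneg D)
      (Nat.one_le_cast.2 (PartitionedProblem.one_le_rho hN)) hL (NNReal.coe_nonneg _) hγ hγ1 hs1
  obtain ⟨Q, W, hQ⟩ := hLip.exists_confinement
  obtain ⟨z, hz⟩ := hrun.exists_isResponseSeq
  obtain ⟨xs, hxs, M, hM⟩ := hz.exists_linear_rate hA hB2 hC hQ hD hEB hε hκ hη hx0 hf hL hγ hγ1
    hs2 hs3 hl0 hl1 hlam
  refine ⟨hl0, hl1, xs, hxs, fun t _ => ⟨?_, ?_⟩⟩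
  · refine IsBigO.of_bound M (Eventually.of_forall fun k => ?_)
    rw [Real.norm_eq_abs, Real.norm_of_nonneg (pow_nonneg hl0.le _)]
    exact (hM _).1
  · refine IsBigO.of_bound M (Eventually.of_forall fun k => ?_)
    rw [norm_norm, Real.norm_of_nonneg (Real.sqrt_nonneg _)]
    exact (hM _).2
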